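/- **Setting.** Let $\mathcal S,\mathcal A$ be finite non-empty sets, $\gamma\in[0,1)$ a discount factor and $\rho$ a probability distribution on $\mathcal S$ (law of the initial state, the same for all MDPs). An MDP $\mathcal M$ consists of transition probabilities $p_{\mathcal M}(\cdot\mid s,a)$ on $\mathcal S$ and reward distributions $q_{\mathcal M}(\cdot\mid s,a)$ on $\mathbb R$ with finite mean. For a policy $\pi:\mathcal S\to\mathcal A$, $V^\pi_{\mathcal M}(s)=\mathbb E[\sum_{t\ge 0}\gamma^tR_t]$ is the expected discounted reward when starting in $s$ and following $\pi$; $\Pi^\star(\mathcal M)$ is the set of optimal policies, i.e. those $\pi$ with $V^{\pi'}_{\mathcal M}(s)\le V^{\pi}_{\mathcal M}(s)$ for all $\pi'$ and $s$. $\mathcal M$ is communicating if every state can be reached with positive probability from every state under some policy $\pi:\mathcal S\to\mathcal A$. Fix any class $\mathbb M$ of MDPs (for instance, all MDPs) and $\mathcal M\in\mathbb M$. Let $$\mathrm{Alt}(\mathcal M)=\{\mathcal M'\in\mathbb M:\ \mathcal M\ll\mathcal M',\ \Pi^\star(\mathcal M)\cap\Pi^\star(\mathcal M')=\emptyset\},$$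 where $\mathcal M\ll\mathcal M'$ means that $p_{\mathcal M}(\cdot|s,a)\ll p_{\mathcal M'}(\cdot|s,a)$ and $q_{\mathcal M}(\cdot|s,a)\ll q_{\mathcal M'}(\cdot|s,a)$ for all $(s,a)$, and let $$\mathrm{KL}_{\mathcal M|\mathcal M'}(s,a)=\mathrm{KL}(q_{\mathcal M}(\cdot|s,a),q_{\mathcal M'}(\cdot|s,a))+\mathrm{KL}(p_{\mathcal M}(\cdot|s,a),p_{\mathcal M'}(\cdot|s,a))\in[0,\infty]$$ (with $0\cdot\infty=0$ below). Write $\mathrm{kl}(a,b)=a\log\frac ab+(1-a)\log\frac{1-a}{1-b}$. An algorithm $\mathbb A$ moves along a single trajectory. In each round it is in a state $s$, chooses an action $a$ (possibly at random, depending on the past), collects a reward drawn from $q_{\mathcal M}(\cdot|s,a)$ and moves to a state drawn from $p_{\mathcal M}(\cdot|s,a)$. It stops after $\tau$ rounds, where $\tau\in\{0,1,2,\dots,\infty\}$ is a stopping time of the filtration $(\mathcal F_t)_{t\ge0}$ generated by the observations of the first $t$ rounds, including the state reached after round $t$; it then recommends an $\mathcal F_\tau$-measurable policy $\hat\pi_\tau$.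 It is $\delta$-PC (over $\mathbb M$) if $\mathbb P_{\mathcal M',\mathbb A}(\tau<\infty,\ \hat\pi_\tau\notin\Pi^\star(\mathcal M'))\le\delta$ for every $\mathcal M'\in\mathbb M$. **Proposition (lower bound with navigation constraints).** 1. *(Finite $\delta$.)* For every $\delta\in(0,1/2]$ and every $\delta$-PC algorithm $\mathbb A$, $\mathbb E_{\mathcal M,\mathbb A}[\tau]$ is at least the value of $$\inf_{n\ge0}\sum_{s,a}n_{sa}\quad\text{s.t.}\quad\Big|\sum_an_{sa}-\sum_{s',a'}p_{\mathcal M}(s|s',a')n_{s'a'}\Big|\le1\ \ \forall s,\qquad\sum_{s,a}n_{sa}\mathrm{KL}_{\mathcal M|\mathcal M'}(s,a)\ge\mathrm{kl}(\delta,1-\delta)\ \ \forall\mathcal M'\in\mathrm{Alt}(\mathcal M).$$ 2. *(Asymptotic.)* If $\mathcal M$ is communicating, then for every family $(\mathbb A_\delta)_{\delta\in(0,1)}$ such that $\mathbb A_\delta$, with stopping time $\tau_\delta$, is $\delta$-PC for each $\delta$, $$\liminf_{\delta\to0}\frac{\mathbb E_{\mathcal M,\mathbb A_\delta}[\tau_\delta]}{\log(1/\delta)}\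 \ge\ T_o(\mathcal M),$$ where $T_o(\mathcal M)$ is the value of $$\inf_{n\ge0}\sum_{s,a}n_{sa}\quad\text{s.t.}\quad\sum_an_{sa}=\sum_{s',a'}p_{\mathcal M}(s|s',a')n_{s'a'}\ \ \forall s,\qquad\sum_{s,a}n_{sa}\mathrm{KL}_{\mathcal M|\mathcal M'}(s,a)\ge1\ \ \forall\mathcal M'\in\mathrm{Alt}(\mathcal M).$$ 3. Moreover $$T_o(\mathcal M)^{-1}=\sup_{\omega\in\Omega(\mathcal M)}\ \inf_{\mathcal M'\in\mathrm{Alt}(\mathcal M)}\ \sum_{s,a}\omega_{sa}\mathrm{KL}_{\mathcal M|\mathcal M'}(s,a),$$ where $\Omega(\mathcal M)$ is the set of probability vectors $\omega$ on $\mathcal S\times\mathcal A$ with $\sum_a\omega_{sa}=\sum_{s',a'}p_{\mathcal M}(s|s',a')\omega_{s'a'}$ for all $s$. Here the infimum over an empty set is $+\infty$, $1/0=+\infty$ and $1/\infty=0$. -/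

import Mathlib

open MeasureTheory ProbabilityTheory Filter Topology
open scoped NNReal ENNReal

noncomputable section

namespace BPI

/-- What is recorded in one round: the state, the action played there, the reward collected. -/
abbrev Obs (S A : Type*) := S × A × ℝ

/-- Infinite trajectories; rounds are numbered `0, 1, 2, …`. -/
abbrev Traj (S A : Type*) := ℕ → Obs S A

/-- What is known before the action of round `t` is chosen: the rounds `0, …, t - 1`
and the current state. -/
abbrev Hist (S A : Type*) (t : ℕ) := (Fin t → Obs S A) × S

variable {S A : Type*} [MeasurableSpace S] [MeasurableSpace A]

/-- An MDP (the discount factor and the law of the initial state are kept apart):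
transition probabilities `p(· | s, a)` and reward distributions `q(· | s, a)` with finite mean. -/
structure MDP (S A : Type*) [MeasurableSpace S] [MeasurableSpace A] where
  trans : Kernel (S × A) S
  reward : Kernel (S × A) ℝ
  trans_markov : IsMarkovKernel trans
  reward_markov : IsMarkovKernel reward
  reward_integrable : ∀ z, Integrable (fun r : ℝ => r) (reward z)

attribute [instance] MDP.trans_markov MDP.reward_markov

/-- A (possibly randomized, history-dependent) sampling rule: `act t (h, s)` is the law of the
action played in round `t` in state `s` after the history `h`. -/
structure SamplingRule (S A : Type*) [MeasurableSpace S] [MeasurableSpace A] where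
  act : ∀ t : ℕ, Kernel (Hist S A t) A
  act_markov : ∀ t, IsMarkovKernel (act t)

attribute [instance] SamplingRule.act_markov

/-- Given the history and the state of round `t`, the law of the record of round `t`:
an action is drawn from the sampling rule, then a reward from the reward distribution. -/
def roundKernel (M : MDP S A) (σ : SamplingRule S A) (t : ℕ) : Kernel (Hist S A t) (Obs S A) :=
  (Kernel.deterministic (fun h : Hist S A t => h.2) measurable_snd) ×ₖ
    (σ.act t ⊗ₖ M.reward.comap (fun ha : Hist S A t × A => (ha.1.2, ha.2)) (by fun_prop))

/-- The records of rounds `0, …, n`, reindexed by `Fin (n + 1)`. -/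
def toFin (n : ℕ) (x : Finset.Iic n → Obs S A) : Fin (n + 1) → Obs S A :=
  fun i => x ⟨i, Finset.mem_Iic.2 (Nat.lt_succ_iff.1 i.2)⟩

theorem measurable_toFin (n : ℕ) : Measurable (toFin n : (Finset.Iic n → Obs S A) → _) :=
  measurable_pi_lambda _ fun _ => measurable_pi_apply _

/-- The state and the action of round `n`. -/
def lastPair (n : ℕ) (x : Finset.Iic n → Obs S A) : S × A :=
  ((x ⟨n, Finset.mem_Iic.2 le_rfl⟩).1, (x ⟨n, Finset.mem_Iic.2 le_rfl⟩).2.1)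

theorem measurable_lastPair (n : ℕ) :
    Measurable (lastPair n : (Finset.Iic n → Obs S A) → S × A) := by
  unfold lastPair; fun_prop

/-- Given rounds `0, …, n`, the law of the record of round `n + 1`: the next state is drawn from
the transition probabilities, then the round is played. -/
def stepKernel (M : MDP S A) (σ : SamplingRule S A) (n : ℕ) :
    Kernel (Finset.Iic n → Obs S A) (Obs S A) :=
  roundKernel M σ (n + 1) ∘ₖ
    (Kernel.deterministic (toFin n) (measurable_toFin n) ×ₖ
      M.trans.comap (lastPair n) (measurable_lastPair n))

instance (M : MDP S A) (σ : SamplingRule S A) (t : ℕ) : IsMarkovKernel (roundKernel M σ t) := by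
  unfold roundKernel; infer_instance

instance (M : MDP S A) (σ : SamplingRule S A) (n : ℕ) : IsMarkovKernel (stepKernel M σ n) := by
  unfold stepKernel; infer_instance

/-- The law of the record of round `0` when the initial state has law `ρ`. -/
def initialLaw (M : MDP S A) (σ : SamplingRule S A) (ρ : Measure S) : Measure (Obs S A) :=
  (ρ.map (fun s : S => ((Fin.elim0, s) : Hist S A 0))).bind (roundKernel M σ 0)

/-- The law of the trajectory when the sampling rule `σ` is run in `M` from the initial law `ρ`
(the Ionescu-Tulcea construction). -/
def law (M : MDP S A) (σ : SamplingRule S A) (ρ : Measure S) : Measure (Traj S A) :=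
  ((initialLaw M σ ρ).map (fun x => (fun _ => x : Finset.Iic 0 → Obs S A))).bind
    (Kernel.traj (X := fun _ => Obs S A) (fun n => stepKernel M σ n) 0)

/-- The sampling rule that follows a stationary deterministic policy. -/
def SamplingRule.ofPolicy [DiscreteMeasurableSpace S] (π : S → A) : SamplingRule S A where
  act t := Kernel.deterministic (fun h : Hist S A t => π h.2)
    ((Measurable.of_discrete (f := π)).comp measurable_snd)
  act_markov _ := inferInstance

/-- The value function `V^π(s) = E[∑ γ^t R_t]` for the trajectory that starts in `s` and
follows `π`. -/
def value [DiscreteMeasurableSpace S] (γ : ℝ) (M : MDP S A) (π : S → A) (s : S) : ℝ :=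
  ∫ x, ∑' t : ℕ, γ ^ t * (x t).2.2 ∂(law M (SamplingRule.ofPolicy π) (Measure.dirac s))

/-- The set `Π*(M)` of optimal policies. -/
def optimalPolicies [DiscreteMeasurableSpace S] (γ : ℝ) (M : MDP S A) : Set (S → A) :=
  {π | ∀ (π' : S → A) (s : S), value γ M π' s ≤ value γ M π s}

/-- `M` is communicating: every state can be reached from every state, in at least one step,
under some deterministic policy. -/
def Communicating (M : MDP S A) : Prop :=
  ∀ s s' : S, ∃ π : S → A, Relation.TransGen (fun u v => M.trans (u, π u) {v} ≠ 0) s s'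

/-- The information available to an algorithm that has completed `t` rounds: these rounds
and the state reached after them. -/
def observed (t : ℕ) (x : Traj S A) : Hist S A t := (fun i => x i, (x t).1)

theorem measurable_observed (t : ℕ) : Measurable (observed t : Traj S A → Hist S A t) := by
  unfold observed; fun_prop

/-- The filtration generated by the observations. -/
def histFiltration (S A : Type*) [MeasurableSpace S] [MeasurableSpace A] :
    Filtration ℕ (inferInstance : MeasurableSpace (Traj S A)) where
  seq t := MeasurableSpace.comap (observed t) inferInstance
  mono' := by
    intro t u htu
    rcases htu.eq_or_lt with rfl | hlt
    · exact le_rfl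
    have hg : Measurable (fun h : Hist S A u =>
        ((fun i : Fin t => h.1 ⟨i, i.2.trans hlt⟩, (h.1 ⟨t, hlt⟩).1) : Hist S A t)) := by
      fun_prop
    rintro B ⟨C, hC, rfl⟩
    exact ⟨_, hg hC, rfl⟩
  le' t := (measurable_observed t).comap_le

/-- An algorithm for the identification of the best policy: a sampling rule, a stopping time `τ`
(the number of completed rounds), and a recommended policy that depends only on what has been
observed when the algorithm stops. -/
structure Algorithm (S A : Type*) [MeasurableSpace S] [MeasurableSpace A] where
  rule : SamplingRule S A
  τ : Traj S A → WithTop ℕ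
  isStoppingTime : IsStoppingTime (histFiltration S A) τ
  decision : Traj S A → S → A
  measurable_decision : Measurable[isStoppingTime.measurableSpace] decision

/-- `𝔸` is `δ`-PC over the class `𝓜`: for each MDP of the class, the probability that it stops and
recommends a policy that is not optimal is at most `δ`. (An algorithm that, with probability at
least `1 - δ`, stops and recommends an optimal policy satisfies this.) -/
def IsPC [DiscreteMeasurableSpace S] (γ : ℝ) (ρ : Measure S) (𝓜 : Set (MDP S A)) (δ : ℝ)
    (𝔸 : Algorithm S A) : Prop :=
  ∀ M ∈ 𝓜, law M 𝔸.rule ρ {x | 𝔸.τ x ≠ ⊤ ∧ 𝔸.decision x ∉ optimalPolicies γ M} ≤ ENNReal.ofReal δ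

/-- The expected sample complexity `E[τ]`, possibly infinite. -/
def expectedSamples (M : MDP S A) (ρ : Measure S) (𝔸 : Algorithm S A) : ℝ≥0∞ :=
  ∫⁻ x, ENat.toENNReal (𝔸.τ x) ∂(law M 𝔸.rule ρ)

/-- `M ≪ M'`: absolute continuity of all transition and reward distributions. -/
def AbsCont (M M' : MDP S A) : Prop :=
  ∀ z, M.trans z ≪ M'.trans z ∧ M.reward z ≪ M'.reward z

/-- The alternative MDPs of `M` within the class `𝓜`. -/
def Alt [DiscreteMeasurableSpace S] (γ : ℝ) (𝓜 : Set (MDP S A)) (M : MDP S A) : Set (MDP S A) :=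
  {M' ∈ 𝓜 | AbsCont M M' ∧ Disjoint (optimalPolicies γ M) (optimalPolicies γ M')}

/-- `KL_{M|M'}(s, a)`, the divergence of one transition and one reward. -/
def pairKL (M M' : MDP S A) (z : S × A) : ℝ≥0∞ :=
  InformationTheory.klDiv (M.reward z) (M'.reward z) +
    InformationTheory.klDiv (M.trans z) (M'.trans z)

/-- The information `∑ n_{sa} KL_{M|M'}(s, a)`. -/
def information [Fintype S] [Fintype A] (M M' : MDP S A) (n : S × A → ℝ≥0) : ℝ≥0∞ :=
  ∑ z, (n z : ℝ≥0∞) * pairKL M M' z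

/-- The divergence of Bernoulli distributions of means `a` and `b`, both in `(0, 1)`. -/
def binaryKL (a b : ℝ) : ℝ := a * Real.log (a / b) + (1 - a) * Real.log ((1 - a) / (1 - b))

/-- The net flow `∑_a n_{sa} - ∑_{s',a'} p(s | s', a') n_{s'a'}`. -/
def netFlow [Fintype S] [Fintype A] (M : MDP S A) (n : S × A → ℝ≥0) (s : S) : ℝ :=
  ∑ a, (n (s, a) : ℝ) - ∑ z, (M.trans z).real {s} * n z

/-- The value of the allocation problem at confidence level `δ`. -/
def boundAt [Fintype S] [Fintype A] [DiscreteMeasurableSpace S] (γ : ℝ) (𝓜 : Set (MDP S A))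
    (M : MDP S A) (δ : ℝ) : ℝ≥0∞ :=
  ⨅ n ∈ {n : S × A → ℝ≥0 | (∀ s, |netFlow M n s| ≤ 1) ∧
    ∀ M' ∈ Alt γ 𝓜 M, ENNReal.ofReal (binaryKL δ (1 - δ)) ≤ information M M' n},
    ∑ z, (n z : ℝ≥0∞)

/-- The value of the asymptotic allocation problem. -/
def asymptoticBound [Fintype S] [Fintype A] [DiscreteMeasurableSpace S] (γ : ℝ)
    (𝓜 : Set (MDP S A)) (M : MDP S A) : ℝ≥0∞ :=
  ⨅ n ∈ {n : S × A → ℝ≥0 | (∀ s, netFlow M n s = 0) ∧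
    ∀ M' ∈ Alt γ 𝓜 M, 1 ≤ information M M' n},
    ∑ z, (n z : ℝ≥0∞)

/-- The set `Ω(M)` of navigation-compatible allocations: probability vectors with zero net flow. -/
def allocations [Fintype S] [Fintype A] (M : MDP S A) : Set (S × A → ℝ≥0) :=
  {ω | ∑ z, ω z = 1 ∧ ∀ s, netFlow M ω s = 0}

end BPI

end

/-! The lower bounds hold because the vector of expected visits to the pairs `(s, a)` before
stopping is a feasible allocation. Its total mass is `E[τ]`. Its net flow at a state compares
departures with arrivals, and these differ only through the first and the last state of the
trajectory, hence by at most one (`sum_totalVisits_state_le`, `sum_totalVisits_next_state_le`).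

The information constraint is a change of measure. For a bounded nonnegative `g` that is known when
the algorithm stops, a Donsker-Varadhan inequality `E_M[g] ≤ log E_{M'}[exp g] + information` is
proved backwards, round by round (`integral_le_of_isStopped`). Replacing `g` by the logarithm of the
conditional mean of `exp g` under `M'` costs at most the divergence of the pair being played, and
nothing after stopping. With `g = l · 1_E`, where `E` says that the recommended policy is optimal
for `M`, the best `l` produces `kl(δ, 1 - δ)` (`binaryKL_le_information`). Values and discounting
enter only through the disjointness of the sets of optimal policies.

In a communicating MDP an imbalance bounded by one is repaired by extra visits of mass at most a
constant independent of `δ` (`exists_balanced`). This constant vanishes after division by `log (1 /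
δ)`, to which `kl(δ, 1 - δ)` is equivalent. The dual formula follows by homogeneity: a nonzero
balanced allocation is a mass times an element of `Ω(M)`. -/

noncomputable section

namespace BPI

/-! ### The Markov chain of histories. -/

section

variable {S A : Type*} [MeasurableSpace S] [MeasurableSpace A]

attribute [fun_prop] measurable_toFin measurable_lastPair measurable_observed

/-- The history obtained by completing the current round with an action, a reward and the next
state. -/
def extend (t : ℕ) (p : Hist S A t × A × ℝ × S) : Hist S A (t + 1) :=
  (Fin.snoc (α := fun _ => Obs S A) p.1.1 (p.1.2, p.2.1, p.2.2.1), p.2.2.2)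

theorem measurable_snoc (t : ℕ) :
    Measurable (fun p : (Fin t → Obs S A) × Obs S A =>
      (Fin.snoc (α := fun _ => Obs S A) p.1 p.2 : Fin (t + 1) → Obs S A)) := by
  refine measurable_pi_lambda _ fun i => ?_
  induction i using Fin.lastCases with
  | last => simpa using measurable_snd
  | cast i => simpa using (by fun_prop)

@[fun_prop]
theorem measurable_extend (t : ℕ) :
    Measurable (extend t : Hist S A t × A × ℝ × S → Hist S A (t + 1)) := by
  unfold extend
  exact ((measurable_snoc t).comp (f := fun p : Hist S A t × A × ℝ × S =>
    (p.1.1, (p.1.2, p.2.1, p.2.2.1))) (by fun_prop)).prodMk (by fun_prop)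

/-- The joint law of the reward and of the next state, given the history and the action. -/
def outcomeKernel (M : MDP S A) (t : ℕ) : Kernel (Hist S A t × A) (ℝ × S) :=
  (M.reward ×ₖ M.trans).comap (fun ha : Hist S A t × A => (ha.1.2, ha.2)) (by fun_prop)

instance (M : MDP S A) (t : ℕ) : IsMarkovKernel (outcomeKernel M t) := by
  unfold outcomeKernel; infer_instance

/-- The one-step transition kernel of the Markov chain of histories. -/
def histKernel (M : MDP S A) (σ : SamplingRule S A) (t : ℕ) :
    Kernel (Hist S A t) (Hist S A (t + 1)) :=
  (Kernel.id ×ₖ (σ.act t ⊗ₖ outcomeKernel M t)).map (extend t)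

instance (M : MDP S A) (σ : SamplingRule S A) (t : ℕ) : IsMarkovKernel (histKernel M σ t) := by
  unfold histKernel
  exact Kernel.IsMarkovKernel.map _ (measurable_extend t)

theorem lintegral_histKernel (M : MDP S A) (σ : SamplingRule S A) (t : ℕ) (h : Hist S A t)
    {f : Hist S A (t + 1) → ℝ≥0∞} (hf : Measurable f) :
    ∫⁻ k, f k ∂histKernel M σ t h =
      ∫⁻ a, ∫⁻ r, ∫⁻ s, f (extend t (h, a, r, s)) ∂M.trans (h.2, a) ∂M.reward (h.2, a)
        ∂σ.act t h := by
  have hfe : Measurable fun p => f (extend t p) := hf.comp (measurable_extend t)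
  rw [histKernel, Kernel.lintegral_map _ (measurable_extend t) _ hf,
    Kernel.lintegral_id_prod hfe, Kernel.lintegral_compProd _ _ _ (by fun_prop)]
  refine lintegral_congr fun a => ?_
  rw [outcomeKernel, Kernel.lintegral_comap, Kernel.lintegral_prod _ _ _ (by fun_prop)]

theorem integral_histKernel (M : MDP S A) (σ : SamplingRule S A) (t : ℕ) (h : Hist S A t)
    {f : Hist S A (t + 1) → ℝ} (hf : Measurable f) {C : ℝ} (hC : ∀ k, |f k| ≤ C) :
    ∫ k, f k ∂histKernel M σ t h =
      ∫ a, ∫ p, f (extend t (h, a, p)) ∂(M.reward (h.2, a)).prod (M.trans (h.2, a))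
        ∂σ.act t h := by
  have hfe : Measurable fun p => f (extend t p) := hf.comp (measurable_extend t)
  rw [histKernel, Kernel.map_apply _ (measurable_extend t),
    integral_map (measurable_extend t).aemeasurable hf.aestronglyMeasurable, Kernel.prod_apply,
    Kernel.id_apply, integral_prod, integral_dirac' _ _
      (StronglyMeasurable.integral_prod_right' (f := fun p => f (extend t p))
        hfe.stronglyMeasurable), integral_compProd]
  · refine integral_congr_ae (ae_of_all _ fun a => ?_)
    simp [outcomeKernel, Kernel.comap_apply, Kernel.prod_apply]
  · exact .of_bound (Measurable.aestronglyMeasurable (by fun_prop)) C (ae_of_all _ fun _ => hC _)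
  · exact .of_bound (Measurable.aestronglyMeasurable (by fun_prop)) C (ae_of_all _ fun _ => hC _)

theorem lintegral_roundKernel (M : MDP S A) (σ : SamplingRule S A) (t : ℕ) (h : Hist S A t)
    {f : Obs S A → ℝ≥0∞} (hf : Measurable f) :
    ∫⁻ z, f z ∂roundKernel M σ t h =
      ∫⁻ a, ∫⁻ r, f (h.2, a, r) ∂M.reward (h.2, a) ∂σ.act t h := by
  rw [roundKernel, Kernel.lintegral_deterministic_prod _ _ _ hf,
    Kernel.lintegral_compProd _ _ _ (by fun_prop)]
  rfl

theorem lintegral_stepKernel (M : MDP S A) (σ : SamplingRule S A) (n : ℕ)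
    (y : Finset.Iic n → Obs S A) {f : Obs S A → ℝ≥0∞} (hf : Measurable f) :
    ∫⁻ z, f z ∂stepKernel M σ n y =
      ∫⁻ s, ∫⁻ z, f z ∂roundKernel M σ (n + 1) (toFin n y, s) ∂M.trans (lastPair n y) := by
  have h1 : Measurable fun k => ∫⁻ z, f z ∂roundKernel M σ (n + 1) k := hf.lintegral_kernel
  rw [stepKernel, Kernel.lintegral_comp _ _ _ hf, Kernel.lintegral_deterministic_prod _ _ _ h1]
  rfl

instance (M : MDP S A) (σ : SamplingRule S A) (ρ : Measure S) [IsProbabilityMeasure ρ] :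
    IsProbabilityMeasure (initialLaw M σ ρ) := by
  unfold initialLaw
  have : IsProbabilityMeasure (ρ.map (fun s : S => ((Fin.elim0, s) : Hist S A 0))) :=
    Measure.isProbabilityMeasure_map (by fun_prop)
  infer_instance

theorem law_eq_trajMeasure (M : MDP S A) (σ : SamplingRule S A) (ρ : Measure S) :
    law M σ ρ = Kernel.trajMeasure (X := fun _ => Obs S A) (initialLaw M σ ρ)
      (fun n => stepKernel M σ n) := rfl

instance (M : MDP S A) (σ : SamplingRule S A) (ρ : Measure S) [IsProbabilityMeasure ρ] :
    IsProbabilityMeasure (law M σ ρ) := by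
  rw [law_eq_trajMeasure]; infer_instance

variable (M : MDP S A) (σ : SamplingRule S A) (ρ : Measure S)

/-- The law of what is known before the action of round `t`. -/
def histLaw (t : ℕ) : Measure (Hist S A t) := (law M σ ρ).map (observed t)

theorem lintegral_law_zero {f : Obs S A → ℝ≥0∞} (hf : Measurable f) :
    ∫⁻ x, f (x 0) ∂law M σ ρ = ∫⁻ z, f z ∂initialLaw M σ ρ := by
  have h1 : (law M σ ρ).map (Preorder.frestrictLe 0) =
      (initialLaw M σ ρ).map (fun x => (fun _ => x : Finset.Iic 0 → Obs S A)) := by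
    rw [law, Measure.map_comp _ _ (by fun_prop), Kernel.traj_map_frestrictLe,
      Kernel.partialTraj_self, Measure.id_comp]
  have hg : Measurable fun y : Finset.Iic 0 → Obs S A => f (y ⟨0, Finset.mem_Iic.2 le_rfl⟩) := by
    fun_prop
  have h2 := congrArg (fun μ => ∫⁻ y, f (y ⟨0, Finset.mem_Iic.2 le_rfl⟩) ∂μ) h1
  beta_reduce at h2
  rw [lintegral_map hg (by fun_prop), lintegral_map hg (by fun_prop)] at h2
  exact h2

variable [IsProbabilityMeasure ρ]

theorem lintegral_law_step (n : ℕ) {f : (Finset.Iic n → Obs S A) × Obs S A → ℝ≥0∞}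
    (hf : Measurable f) :
    ∫⁻ x, f (Preorder.frestrictLe n x, x (n + 1)) ∂law M σ ρ =
      ∫⁻ x, ∫⁻ z, f (Preorder.frestrictLe n x, z) ∂stepKernel M σ n (Preorder.frestrictLe n x)
        ∂law M σ ρ := by
  have key := Kernel.map_frestrictLe_trajMeasure_compProd_eq_map_trajMeasure
    (X := fun _ => Obs S A) (μ₀ := initialLaw M σ ρ) (κ := fun n => stepKernel M σ n) (a := n)
  rw [← law_eq_trajMeasure] at key
  have h2 := congrArg (fun μ => ∫⁻ p, f p ∂μ) key
  beta_reduce at h2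
  rw [lintegral_map hf (by fun_prop), Measure.lintegral_compProd hf,
    lintegral_map hf.lintegral_kernel_prod_right' (by fun_prop)] at h2
  exact h2.symm

theorem lintegral_law_next_state (n : ℕ) {f : (Fin (n + 1) → Obs S A) × S → ℝ≥0∞}
    (hf : Measurable f) :
    ∫⁻ x, f (observed (n + 1) x) ∂law M σ ρ =
      ∫⁻ x, ∫⁻ s, f (fun i => x i, s) ∂M.trans ((x n).1, (x n).2.1) ∂law M σ ρ := by
  have hg : Measurable fun p : (Finset.Iic n → Obs S A) × Obs S A => f (toFin n p.1, p.2.1) :=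
    hf.comp (((measurable_toFin n).comp measurable_fst).prodMk (by fun_prop))
  refine (lintegral_law_step M σ ρ n hg).trans (lintegral_congr fun x => ?_)
  rw [lintegral_stepKernel _ _ _ _ (by fun_prop)]
  refine lintegral_congr fun s => ?_
  rw [lintegral_roundKernel _ _ _ _ (by fun_prop)]
  simp
  rfl

theorem lintegral_law_round (n : ℕ) {f : Hist S A n × Obs S A → ℝ≥0∞} (hf : Measurable f) :
    ∫⁻ x, f (observed n x, x n) ∂law M σ ρ =
      ∫⁻ x, ∫⁻ z, f (observed n x, z) ∂roundKernel M σ n (observed n x) ∂law M σ ρ := by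
  -- Round `0` comes from the initial law, every later round from `stepKernel`.
  cases n with
  | zero =>
    have h0 : ∀ x : Traj S A, observed 0 x = (Fin.elim0, (x 0).1) := fun x =>
      Prod.ext (Subsingleton.elim _ _) rfl
    have hh : Measurable fun h : Hist S A 0 => ∫⁻ z, f (h, z) ∂roundKernel M σ 0 h :=
      hf.lintegral_kernel_prod_right'
    have hf1 : Measurable fun z : Obs S A => f ((Fin.elim0, z.1), z) := by fun_prop
    have hf2 : Measurable fun z : Obs S A =>
        ∫⁻ w, f ((Fin.elim0, z.1), w) ∂roundKernel M σ 0 (Fin.elim0, z.1) :=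
      hh.comp (g := fun h => ∫⁻ z, f (h, z) ∂roundKernel M σ 0 h)
        (f := fun z : Obs S A => ((Fin.elim0, z.1) : Hist S A 0)) (by fun_prop)
    simp only [h0]
    rw [lintegral_law_zero M σ ρ hf1, lintegral_law_zero M σ ρ hf2, initialLaw,
      Measure.lintegral_bind (by fun_prop) hf1.aemeasurable,
      Measure.lintegral_bind (by fun_prop) hf2.aemeasurable]
    refine lintegral_congr fun h => ?_
    rw [lintegral_roundKernel _ _ _ _ hf1, lintegral_roundKernel _ _ _ _ hf2]
    have h1 : ((Fin.elim0, h.2) : Hist S A 0) = h := Prod.ext (Subsingleton.elim _ _) rfl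
    simp only [h1, lintegral_const, measure_univ, mul_one]
    rw [lintegral_roundKernel _ _ _ _ (by fun_prop)]
  | succ n =>
    have hh : Measurable fun h : Hist S A (n + 1) =>
        ∫⁻ z, f (h, z) ∂roundKernel M σ (n + 1) h := hf.lintegral_kernel_prod_right'
    rw [lintegral_law_next_state M σ ρ n hh]
    have hg : Measurable fun p : (Finset.Iic n → Obs S A) × Obs S A =>
        f ((toFin n p.1, p.2.1), p.2) :=
      hf.comp ((((measurable_toFin n).comp measurable_fst).prodMk (by fun_prop)).prodMk
        (by fun_prop))
    refine (lintegral_law_step M σ ρ n hg).trans (lintegral_congr fun x => ?_)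
    rw [lintegral_stepKernel _ _ _ _ (by fun_prop)]
    refine lintegral_congr fun s => ?_
    rw [lintegral_roundKernel _ _ _ _ (by fun_prop), lintegral_roundKernel _ _ _ _ (by fun_prop)]
    rfl

instance (t : ℕ) : IsProbabilityMeasure (histLaw M σ ρ t) :=
  Measure.isProbabilityMeasure_map (measurable_observed t).aemeasurable

omit [IsProbabilityMeasure ρ] in
theorem histLaw_zero : histLaw M σ ρ 0 = ρ.map (fun s : S => ((Fin.elim0, s) : Hist S A 0)) := by
  refine Measure.ext_of_lintegral _ fun f hf => ?_
  have h0 : ∀ x : Traj S A, observed 0 x = (Fin.elim0, (x 0).1) := fun x =>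
    Prod.ext (Subsingleton.elim _ _) rfl
  have hf1 : Measurable fun z : Obs S A => f (Fin.elim0, z.1) := by fun_prop
  rw [histLaw, lintegral_map hf (measurable_observed 0)]
  simp only [h0]
  rw [lintegral_law_zero M σ ρ hf1, initialLaw,
      Measure.lintegral_bind (by fun_prop) hf1.aemeasurable]
  refine lintegral_congr fun h => ?_
  rw [lintegral_roundKernel _ _ _ _ hf1]
  have h1 : ((Fin.elim0, h.2) : Hist S A 0) = h := Prod.ext (Subsingleton.elim _ _) rfl
  simp [h1]

/-- The trajectory is built by drawing a transition and then a round. Here the same process is cut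
at the states instead, so that in one step `M` enters only through the reward and the next state
drawn from a single pair `(s, a)`. -/
theorem histLaw_succ (t : ℕ) :
    histLaw M σ ρ (t + 1) = (histLaw M σ ρ t).bind (histKernel M σ t) := by
  refine Measure.ext_of_lintegral _ fun f hf => ?_
  rw [Measure.lintegral_bind (by fun_prop) hf.aemeasurable, histLaw, histLaw,
    lintegral_map hf (measurable_observed _),
    lintegral_map (hf.lintegral_kernel) (measurable_observed _), lintegral_law_next_state _ _ _ _ hf]
  have hg : Measurable fun p : Hist S A t × Obs S A =>
      ∫⁻ s, f (Fin.snoc (α := fun _ => Obs S A) p.1.1 p.2, s) ∂M.trans (p.2.1, p.2.2.1) := by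
    have h1 : Measurable fun q : (Hist S A t × Obs S A) × S =>
        f (Fin.snoc (α := fun _ => Obs S A) q.1.1.1 q.1.2, q.2) :=
      hf.comp (((measurable_snoc t).comp (f := fun q : (Hist S A t × Obs S A) × S =>
        (q.1.1.1, q.1.2)) (by fun_prop)).prodMk measurable_snd)
    exact h1.lintegral_kernel_prod_right' (κ := M.trans.comap
      (fun p : Hist S A t × Obs S A => (p.2.1, p.2.2.1)) (by fun_prop))
  have h2 : ∀ x : Traj S A, (fun i : Fin (t + 1) => x i) =
      Fin.snoc (α := fun _ => Obs S A) (observed t x).1 (x t) := by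
    intro x
    ext i : 1
    induction i using Fin.lastCases <;> simp [observed]
  simp only [h2]
  rw [lintegral_law_round M σ ρ t hg]
  refine lintegral_congr fun x => ?_
  refine (lintegral_roundKernel _ _ _ _ (hg.comp measurable_prodMk_left)).trans ?_
  rw [lintegral_histKernel _ _ _ _ hf]
  rfl

end

/-! ### The Donsker-Varadhan inequality for one round. -/

section

/-- The Donsker-Varadhan inequality for functions with values in `[0, B]`; the divergence may be
truncated at `B`. -/
theorem integral_le_log_integral_exp_add_klDiv {α : Type*} [MeasurableSpace α] (μ ν : Measure α)
    [IsProbabilityMeasure μ] [IsProbabilityMeasure ν] {f : α → ℝ} {B : ℝ} (hf : Measurable f)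
    (h0 : ∀ x, 0 ≤ f x) (hB : ∀ x, f x ≤ B) :
    ∫ x, f x ∂μ ≤ Real.log (∫ x, Real.exp (f x) ∂ν) +
      (min (InformationTheory.klDiv μ ν) (ENNReal.ofReal B)).toReal := by
  have hB0 : 0 ≤ B := by
    obtain ⟨x⟩ := μ.nonempty_of_neZero
    exact (h0 x).trans (hB x)
  have hfμ : Integrable f μ := .of_bound hf.aestronglyMeasurable B
    (ae_of_all _ fun x => by rw [Real.norm_eq_abs, abs_of_nonneg (h0 x)]; exact hB x)
  have hfν : Integrable (fun x => Real.exp (f x)) ν :=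
    .of_bound (by fun_prop) (Real.exp B) (ae_of_all _ fun x => by
      rw [Real.norm_eq_abs, abs_of_pos (Real.exp_pos _)]; exact Real.exp_le_exp.2 (hB x))
  have h1 : 1 ≤ ∫ x, Real.exp (f x) ∂ν := by
    have := integral_mono (integrable_const (1 : ℝ)) hfν fun x => Real.one_le_exp (h0 x)
    simpa using this
  have hlog : 0 ≤ Real.log (∫ x, Real.exp (f x) ∂ν) := Real.log_nonneg h1
  -- If the divergence is at least `B`, the claim is trivial since `f ≤ B` and the logarithm is
  -- nonnegative. Otherwise it is finite, and the claim is the nonnegativity of the divergence of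
  -- `μ` from `ν` tilted by `f`.
  by_cases hle : ENNReal.ofReal B ≤ InformationTheory.klDiv μ ν
  · rw [min_eq_right hle, ENNReal.toReal_ofReal hB0]
    have := integral_mono hfμ (integrable_const B) hB
    simp only [integral_const, probReal_univ, smul_eq_mul, one_mul] at this
    linarith
  · rw [min_eq_left (not_le.1 hle).le]
    obtain ⟨hac, hint⟩ := InformationTheory.klDiv_ne_top_iff.1
      ((not_le.1 hle).trans ENNReal.ofReal_lt_top).ne
    have : IsProbabilityMeasure (ν.tilted f) := isProbabilityMeasure_tilted hfν
    have h2 := InformationTheory.integral_llr_add_sub_measure_univ_nonneg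
      (hac.trans (absolutelyContinuous_tilted hfν)) (integrable_llr_tilted_right hac hfμ hint hfν)
    rw [integral_llr_tilted_right hac hfμ hfν hint] at h2
    rw [InformationTheory.toReal_klDiv_of_measure_eq hac (by simp)]
    simp at h2
    linarith

theorem integral_log_le_log_integral {α : Type*} [MeasurableSpace α] (μ : Measure α)
    [IsProbabilityMeasure μ] {f : α → ℝ} {B : ℝ} (hf : Measurable f)
    (h0 : ∀ x, 0 ≤ f x) (hB : ∀ x, f x ≤ B) :
    ∫ x, f x ∂μ ≤ Real.log (∫ x, Real.exp (f x) ∂μ) := by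
  simpa using integral_le_log_integral_exp_add_klDiv μ μ hf h0 hB

/-- The chain rule splits off the first factor; a swap of the coordinates, under which the
divergence cannot grow, brings the second one into the same form. -/
theorem klDiv_prod_le {α β : Type*} [MeasurableSpace α] [MeasurableSpace β]
    (μ μ' : Measure α) (ν ν' : Measure β) [IsProbabilityMeasure μ] [IsProbabilityMeasure μ']
    [IsProbabilityMeasure ν] [IsProbabilityMeasure ν'] :
    InformationTheory.klDiv (μ.prod ν) (μ'.prod ν') ≤
      InformationTheory.klDiv μ μ' + InformationTheory.klDiv ν ν' := by
  have h := InformationTheory.klDiv_compProd_eq_add μ μ' (Kernel.const α ν) (Kernel.const α ν')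
  rw [Measure.compProd_const, Measure.compProd_const, Measure.compProd_const] at h
  rw [h]
  gcongr
  have h2 := InformationTheory.klDiv_compProd_left ν ν' (Kernel.const β μ)
  rw [Measure.compProd_const, Measure.compProd_const] at h2
  rw [← h2, ← Measure.prod_swap (μ := ν), ← Measure.prod_swap (μ := ν')]
  exact InformationTheory.klDiv_map_le _ _ measurable_swap

theorem one_le_integral_exp {α : Type*} [MeasurableSpace α] (μ : Measure α)
    [IsProbabilityMeasure μ] {f : α → ℝ} {B : ℝ} (hf : Measurable f)
    (h0 : ∀ x, 0 ≤ f x) (hB : ∀ x, f x ≤ B) :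
    1 ≤ ∫ x, Real.exp (f x) ∂μ ∧ ∫ x, Real.exp (f x) ∂μ ≤ Real.exp B := by
  have hint : Integrable (fun x => Real.exp (f x)) μ :=
    .of_bound (by fun_prop) (Real.exp B) (ae_of_all _ fun x => by
      rw [Real.norm_eq_abs, abs_of_pos (Real.exp_pos _)]; exact Real.exp_le_exp.2 (hB x))
  constructor
  · simpa using integral_mono (integrable_const (1 : ℝ)) hint fun x => Real.one_le_exp (h0 x)
  · simpa using integral_mono hint (integrable_const (Real.exp B))
      fun x => Real.exp_le_exp.2 (hB x)

variable {S A : Type*} [MeasurableSpace S] [MeasurableSpace A]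

/-- The truncated divergence `min (KL_{M|M'}(s, a)) B`. -/
def truncKL (M M' : MDP S A) (B : ℝ) (z : S × A) : ℝ≥0∞ := min (pairKL M M' z) (ENNReal.ofReal B)

theorem truncKL_ne_top (M M' : MDP S A) (B : ℝ) (z : S × A) : truncKL M M' B z ≠ ∞ :=
  ((min_le_right _ _).trans_lt ENNReal.ofReal_lt_top).ne

theorem integral_outcome_le (M M' : MDP S A) (z : S × A) {f : ℝ × S → ℝ} {B : ℝ}
    (hf : Measurable f) (h0 : ∀ x, 0 ≤ f x) (hB : ∀ x, f x ≤ B) :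
    ∫ p, f p ∂(M.reward z).prod (M.trans z) ≤
      Real.log (∫ p, Real.exp (f p) ∂(M'.reward z).prod (M'.trans z)) +
        (truncKL M M' B z).toReal := by
  refine (integral_le_log_integral_exp_add_klDiv _ ((M'.reward z).prod (M'.trans z)) hf h0
    hB).trans ?_
  gcongr
  · exact truncKL_ne_top M M' B z
  · exact min_le_min_right _ (klDiv_prod_le _ _ _ _)

/-- The action has the same law under both MDPs, so randomizing it costs nothing: Jensen's
inequality moves the logarithm outside the mean over actions. Only the outcome of the action
contributes a divergence. -/
theorem integral_histKernel_le [DiscreteMeasurableSpace S] [DiscreteMeasurableSpace A]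
    [Finite S] [Finite A] (M M' : MDP S A) (σ : SamplingRule S A) (t : ℕ)
    (h : Hist S A t) {g : Hist S A (t + 1) → ℝ} {B : ℝ} (hg : Measurable g) (h0 : ∀ k, 0 ≤ g k)
    (hB : ∀ k, g k ≤ B) :
    ∫ k, g k ∂histKernel M σ t h ≤ Real.log (∫ k, Real.exp (g k) ∂histKernel M' σ t h) +
      ∫ a, (truncKL M M' B (h.2, a)).toReal ∂σ.act t h := by
  have hgB : ∀ k, |g k| ≤ B := fun k => by rw [abs_of_nonneg (h0 k)]; exact hB k
  have heB : ∀ k, |Real.exp (g k)| ≤ Real.exp B := fun k => by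
    rw [abs_of_pos (Real.exp_pos _)]; exact Real.exp_le_exp.2 (hB k)
  rw [integral_histKernel M σ t h hg hgB, integral_histKernel M' σ t h (by fun_prop) heB]
  set X : A → ℝ := fun a => ∫ p, Real.exp (g (extend t (h, a, p)))
    ∂(M'.reward (h.2, a)).prod (M'.trans (h.2, a))
  have hX : ∀ a, 1 ≤ X a ∧ X a ≤ Real.exp B := fun a =>
    one_le_integral_exp _ (by fun_prop) (fun p => h0 _) (fun p => hB _)
  have hpos : ∀ a, 0 < X a := fun a => zero_lt_one.trans_le (hX a).1
  calc ∫ a, ∫ p, g (extend t (h, a, p)) ∂(M.reward (h.2, a)).prod (M.trans (h.2, a)) ∂σ.act t h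
      ≤ ∫ a, (Real.log (X a) + (truncKL M M' B (h.2, a)).toReal) ∂σ.act t h :=
        integral_mono .of_finite .of_finite fun a =>
          integral_outcome_le M M' (h.2, a) (by fun_prop) (fun _ => h0 _) (fun _ => hB _)
    _ = ∫ a, Real.log (X a) ∂σ.act t h + ∫ a, (truncKL M M' B (h.2, a)).toReal ∂σ.act t h :=
        integral_add .of_finite .of_finite
    _ ≤ _ := by
        gcongr
        refine (integral_log_le_log_integral (σ.act t h) (B := B) .of_discrete
          (fun a => Real.log_nonneg (hX a).1)
          (fun a => (Real.log_le_iff_le_exp (hpos a)).2 (hX a).2)).trans_eq ?_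
        simp only [Real.exp_log (hpos _)]

end

/-! ### Change of measure up to the stopping time. -/

section

variable {S A : Type*} [MeasurableSpace S] [MeasurableSpace A]

-- The stopping time lives on trajectories; surjectivity of `observed t` turns the event of having
-- stopped into a property of histories.
omit [MeasurableSpace S] [MeasurableSpace A] in
theorem exists_observed_eq [Nonempty A] (t : ℕ) (h : Hist S A t) :
    ∃ x : Traj S A, observed t x = h :=
  ⟨fun i => if hi : i < t then h.1 ⟨i, hi⟩ else (h.2, Classical.arbitrary A, 0), by
    refine Prod.ext (funext fun i => ?_) ?_ <;> simp [observed]⟩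

omit [MeasurableSpace S] [MeasurableSpace A] in
theorem exists_observed_eq_extend [Nonempty A] (t : ℕ) (h : Hist S A t) (p : A × ℝ × S) :
    ∃ x : Traj S A, observed t x = h ∧ observed (t + 1) x = extend t (h, p) := by
  obtain ⟨x, hx⟩ := exists_observed_eq (t + 1) (extend t (h, p))
  refine ⟨x, ?_, hx⟩
  have h1 : ∀ i : Fin (t + 1), x i = (extend t (h, p)).1 i := fun i => by rw [← hx]; rfl
  refine Prod.ext (funext fun i => ?_) ?_
  · simpa [extend, observed] using h1 i.castSucc
  · simpa [extend, observed] using congrArg Prod.fst (h1 (Fin.last t))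

theorem integral_histLaw_succ (M : MDP S A) (σ : SamplingRule S A) (ρ : Measure S)
    [IsProbabilityMeasure ρ] (t : ℕ) {f : Hist S A (t + 1) → ℝ} (hf : Measurable f) {C : ℝ}
    (hC : ∀ k, |f k| ≤ C) :
    ∫ k, f k ∂histLaw M σ ρ (t + 1) =
      ∫ h, ∫ k, f k ∂histKernel M σ t h ∂histLaw M σ ρ t := by
  have hfi : Integrable f (histLaw M σ ρ (t + 1)) :=
    .of_bound hf.aestronglyMeasurable C (ae_of_all _ hC)
  rw [histLaw_succ, Measure.comp_eq_comp_const_apply] at hfi ⊢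
  rw [Kernel.integral_comp hfi]
  rfl

namespace Algorithm

variable (𝔸 : Algorithm S A)

/-- The histories of length `t` after which the algorithm has stopped. -/
def stopped (t : ℕ) : Set (Hist S A t) := observed t '' {x | 𝔸.τ x ≤ t}

theorem exists_measurableSet_observed {E : Set (Traj S A)}
    (hE : MeasurableSet[𝔸.isStoppingTime.measurableSpace] E) (t : ℕ) :
    ∃ C : Set (Hist S A t), MeasurableSet C ∧ observed t ⁻¹' C = E ∩ {x | 𝔸.τ x ≤ t} :=
  ((𝔸.isStoppingTime.measurableSet E).1 hE).2 t

variable [Nonempty A]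

theorem stopped_spec (t : ℕ) :
    MeasurableSet (𝔸.stopped t) ∧ observed t ⁻¹' 𝔸.stopped t = {x | 𝔸.τ x ≤ t} := by
  obtain ⟨C, hC, hCE⟩ := 𝔸.exists_measurableSet_observed .univ t
  have : 𝔸.stopped t = C := by
    rw [stopped, ← Set.univ_inter {x | 𝔸.τ x ≤ t}, ← hCE]
    exact Set.image_preimage_eq _ fun h => exists_observed_eq t h
  rw [this, hCE, Set.univ_inter]
  exact ⟨hC, rfl⟩

theorem observed_mem_stopped {t : ℕ} {x : Traj S A} :
    observed t x ∈ 𝔸.stopped t ↔ 𝔸.τ x ≤ t :=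
  Set.ext_iff.1 (𝔸.stopped_spec t).2 x

theorem le_of_observed_eq {t : ℕ} {x y : Traj S A} (h : observed t x = observed t y)
    (hx : 𝔸.τ x ≤ t) : 𝔸.τ y ≤ t := by
  rw [← observed_mem_stopped] at hx ⊢
  rwa [← h]

/-- A function of the history of length `t` that depends only on what has been observed when the
algorithm stops. -/
def IsStopped (t : ℕ) (g : Hist S A t → ℝ) : Prop :=
  ∀ (x y : Traj S A) (u : ℕ), u ≤ t → 𝔸.τ x ≤ u → observed u x = observed u y →
    g (observed t x) = g (observed t y)

/-- The expected number of times that the action of `z` is played in the state of `z` in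
round `t`, before the algorithm stops. -/
def visits (M : MDP S A) (ρ : Measure S) (t : ℕ) (z : S × A) : ℝ≥0∞ :=
  ∫⁻ h in (𝔸.stopped t)ᶜ, ({h : Hist S A t | h.2 = z.1}.indicator
    (fun h => 𝔸.rule.act t h {z.2}) h) ∂histLaw M 𝔸.rule ρ t

variable [Fintype S] [Fintype A] [DiscreteMeasurableSpace S] [DiscreteMeasurableSpace A]
  (M M' : MDP S A) (ρ : Measure S)

omit [Nonempty A] in
theorem lintegral_running (t : ℕ) (K : S × A → ℝ≥0∞) :
    ∫⁻ h in (𝔸.stopped t)ᶜ, ∫⁻ a, K (h.2, a) ∂𝔸.rule.act t h ∂histLaw M 𝔸.rule ρ t =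
      ∑ z, 𝔸.visits M ρ t z * K z := by
  classical
  have hm : ∀ z : S × A, Measurable ({h : Hist S A t | h.2 = z.1}.indicator
      (fun h => 𝔸.rule.act t h {z.2})) := fun z =>
    ((𝔸.rule.act t).measurable_coe (.of_discrete)).indicator
      (measurable_snd (.of_discrete (s := {z.1})))
  simp only [visits]
  rw [Finset.sum_congr rfl fun z _ => (lintegral_mul_const (K z) (hm z)).symm,
    ← lintegral_finsetSum _ fun z _ => (hm z).mul_const _]
  refine lintegral_congr fun h => ?_
  rw [lintegral_fintype, Fintype.sum_prod_type, Finset.sum_eq_single h.2]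
  · simp [mul_comm]
  · intro s _ hs
    simp [hs.symm]
  · simp

theorem sum_visits [IsProbabilityMeasure ρ] (t : ℕ) :
    ∑ z, 𝔸.visits M ρ t z = law M 𝔸.rule ρ {x | (t : WithTop ℕ) < 𝔸.τ x} := by
  have h := 𝔸.lintegral_running M ρ t (fun _ => 1)
  simp only [lintegral_const, measure_univ, mul_one, one_mul] at h
  rw [← h, Measure.restrict_apply_univ, histLaw, Measure.map_apply (measurable_observed t)
    (𝔸.stopped_spec t).1.compl, Set.preimage_compl, (𝔸.stopped_spec t).2]
  congr 1
  ext x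
  simp

/-- Backward induction. The bound `B` on `g` is inherited by every earlier function, so one
truncation level serves all rounds and infinite divergences need no separate treatment. -/
theorem integral_le_of_isStopped [IsProbabilityMeasure ρ] (B : ℝ) (t : ℕ) :
    ∀ g : Hist S A t → ℝ, Measurable g → (∀ h, 0 ≤ g h) → (∀ h, g h ≤ B) → 𝔸.IsStopped t g →
      ∫ h, g h ∂histLaw M 𝔸.rule ρ t ≤
        Real.log (∫ h, Real.exp (g h) ∂histLaw M' 𝔸.rule ρ t) +
          (∑ u ∈ Finset.range t, ∑ z, 𝔸.visits M ρ u z * truncKL M M' B z).toReal := by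
  induction t with
  | zero =>
    intro g hg h0 hB _
    -- The initial law does not depend on the MDP, so Jensen's inequality suffices.
    have := integral_log_le_log_integral (histLaw M 𝔸.rule ρ 0) hg h0 hB
    simpa [histLaw_zero] using this
  | succ t ih =>
    intro g hg h0 hB hst
    set g' : Hist S A t → ℝ := fun h =>
      Real.log (∫ k, Real.exp (g k) ∂histKernel M' 𝔸.rule t h)
    have hb := fun h => one_le_integral_exp (histKernel M' 𝔸.rule t h) hg h0 hB
    have hpos := fun h => zero_lt_one.trans_le (hb h).1
    have hg' : Measurable g' := by
      refine Real.measurable_log.comp (StronglyMeasurable.measurable ?_)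
      exact StronglyMeasurable.integral_kernel (by fun_prop : Measurable _).stronglyMeasurable
    have hg'0 : ∀ h, 0 ≤ g' h := fun h => Real.log_nonneg (hb h).1
    have hg'B : ∀ h, g' h ≤ B := fun h => (Real.log_le_iff_le_exp (hpos h)).2 (hb h).2
    have hint' : Integrable g' (histLaw M 𝔸.rule ρ t) :=
      .of_bound hg'.aestronglyMeasurable B
        (ae_of_all _ fun x => by rw [Real.norm_eq_abs, abs_of_nonneg (hg'0 x)]; exact hg'B x)
    -- After stopping, `g` does not depend on how the history continues, so averaging over the next
    -- round changes nothing, whatever the MDP.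
    have hconst : ∀ (N : MDP S A) (x : Traj S A), 𝔸.τ x ≤ t → ∀ φ : ℝ → ℝ, Measurable φ →
        (∃ C, ∀ k, |φ (g k)| ≤ C) →
        ∫ k, φ (g k) ∂histKernel N 𝔸.rule t (observed t x) = φ (g (observed (t + 1) x)) := by
      rintro N x hx φ hφ ⟨C, hC⟩
      rw [integral_histKernel N 𝔸.rule t _ (f := fun k => φ (g k)) (hφ.comp hg) hC]
      have : ∀ p, g (extend t (observed t x, p)) = g (observed (t + 1) x) := by
        intro p
        obtain ⟨y, hy, hy'⟩ := exists_observed_eq_extend t (observed t x) p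
        rw [← hy']
        exact (hst x y t t.le_succ hx hy.symm).symm
      simp [this]
    have hexpb : ∀ k, |Real.exp (g k)| ≤ Real.exp B := fun k => by
      rw [abs_of_pos (Real.exp_pos _)]; exact Real.exp_le_exp.2 (hB k)
    have hg's : ∀ x : Traj S A, 𝔸.τ x ≤ t → g' (observed t x) = g (observed (t + 1) x) :=
      fun x hx => by
        simp only [g']
        rw [hconst M' x hx Real.exp Real.measurable_exp ⟨_, hexpb⟩, Real.log_exp]
    have hg'stopped : 𝔸.IsStopped t g' := by
      intro x y u hu hx hxy
      have hy := 𝔸.le_of_observed_eq hxy hx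
      have hut : (u : WithTop ℕ) ≤ t := by exact_mod_cast hu
      rw [hg's x (hx.trans hut), hg's y (hy.trans hut)]
      exact hst x y u (hu.trans t.le_succ) hx hxy
    -- The divergence is charged only to histories that are still running.
    set R : Hist S A t → ℝ≥0∞ := (𝔸.stopped t)ᶜ.indicator
      fun h => ∫⁻ a, truncKL M M' B (h.2, a) ∂𝔸.rule.act t h
    have hKm : Measurable fun h : Hist S A t =>
        ∫⁻ a, truncKL M M' B (h.2, a) ∂𝔸.rule.act t h :=
      Measurable.lintegral_kernel_prod_right'
        (f := fun p : Hist S A t × A => truncKL M M' B (p.1.2, p.2))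
        ((Measurable.of_discrete (f := truncKL M M' B)).comp
          (by fun_prop : Measurable fun p : Hist S A t × A => (p.1.2, p.2)))
    have hKB : ∀ h : Hist S A t,
        ∫⁻ a, truncKL M M' B (h.2, a) ∂𝔸.rule.act t h ≤ ENNReal.ofReal B := fun h =>
      (lintegral_mono fun a => min_le_right _ _).trans_eq (by simp)
    have hRm : Measurable R := hKm.indicator (𝔸.stopped_spec t).1.compl
    have hRB : ∀ h, R h ≤ ENNReal.ofReal B := fun h =>
      (Set.indicator_le_self _ _ h).trans (hKB h)
    have hRfin : ∀ h, R h < ∞ := fun h => (hRB h).trans_lt ENNReal.ofReal_lt_top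
    have hR : ∫⁻ h, R h ∂histLaw M 𝔸.rule ρ t =
        ∑ z, 𝔸.visits M ρ t z * truncKL M M' B z := by
      rw [← lintegral_running, lintegral_indicator (𝔸.stopped_spec t).1.compl]
    have hRtop : ∫⁻ h, R h ∂histLaw M 𝔸.rule ρ t ≠ ∞ :=
      ((lintegral_mono hRB).trans_lt (by simp)).ne
    have hstep : ∀ h, ∫ k, g k ∂histKernel M 𝔸.rule t h ≤ g' h + (R h).toReal := by
      intro h
      by_cases hh : h ∈ 𝔸.stopped t
      · obtain ⟨x, hx, rfl⟩ := hh
        refine (hconst M x hx id measurable_id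
          ⟨B, fun k => by rw [id, abs_of_nonneg (h0 k)]; exact hB k⟩).trans_le ?_
        simp [hg's x hx]
      · have hRh : R h = ∫⁻ a, truncKL M M' B (h.2, a) ∂𝔸.rule.act t h :=
          Set.indicator_of_mem (s := (𝔸.stopped t)ᶜ) hh _
        rw [hRh, ← integral_toReal Measurable.of_discrete.aemeasurable
          (ae_of_all _ fun a => (truncKL_ne_top M M' B _).lt_top)]
        exact integral_histKernel_le M M' 𝔸.rule t h hg h0 hB
    have hfinprev : ∑ u ∈ Finset.range t, ∑ z, 𝔸.visits M ρ u z * truncKL M M' B z ≠ ∞ := by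
      refine ENNReal.sum_ne_top.2 fun u _ => ENNReal.sum_ne_top.2 fun z _ =>
        ENNReal.mul_ne_top ?_ (truncKL_ne_top M M' B z)
      refine ne_top_of_le_ne_top (measure_ne_top (law M 𝔸.rule ρ) _)
        ((Finset.single_le_sum (f := 𝔸.visits M ρ u) (fun _ _ => zero_le) (Finset.mem_univ z)).trans_eq (𝔸.sum_visits M ρ u))
    rw [Finset.sum_range_succ, ENNReal.toReal_add hfinprev (hR ▸ hRtop), ← hR,
      ← integral_toReal hRm.aemeasurable (ae_of_all _ hRfin)]
    have hexp : ∫ h, Real.exp (g h) ∂histLaw M' 𝔸.rule ρ (t + 1) =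
        ∫ h, Real.exp (g' h) ∂histLaw M' 𝔸.rule ρ t := by
      rw [integral_histLaw_succ _ _ _ _ (by fun_prop) hexpb]
      simp only [g', Real.exp_log (hpos _)]
    have hgB : ∀ k, |g k| ≤ B := fun k => by rw [abs_of_nonneg (h0 k)]; exact hB k
    have hRi : Integrable (fun h => (R h).toReal) (histLaw M 𝔸.rule ρ t) :=
      integrable_toReal_of_lintegral_ne_top hRm.aemeasurable hRtop
    have hgi : Integrable (fun h => ∫ k, g k ∂histKernel M 𝔸.rule t h) (histLaw M 𝔸.rule ρ t) := by
      refine .of_bound (StronglyMeasurable.integral_kernel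
        hg.stronglyMeasurable).aestronglyMeasurable B (ae_of_all _ fun h => ?_)
      exact (norm_integral_le_of_norm_le_const (ae_of_all _ hgB)).trans (by simp)
    calc ∫ h, g h ∂histLaw M 𝔸.rule ρ (t + 1)
        = ∫ h, ∫ k, g k ∂histKernel M 𝔸.rule t h ∂histLaw M 𝔸.rule ρ t :=
          integral_histLaw_succ _ _ _ _ hg hgB
      _ ≤ ∫ h, (g' h + (R h).toReal) ∂histLaw M 𝔸.rule ρ t :=
          integral_mono hgi (hint'.add hRi) hstep
      _ = ∫ h, g' h ∂histLaw M 𝔸.rule ρ t + ∫ h, (R h).toReal ∂histLaw M 𝔸.rule ρ t :=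
          integral_add hint' hRi
      _ ≤ _ := by
          rw [hexp]
          have := ih g' hg' hg'0 hg'B hg'stopped
          linarith

end Algorithm

end

/-! ### Transport of probabilities and the flow of expected visits. -/

section

variable {S A : Type*} [MeasurableSpace S] [MeasurableSpace A]

namespace Algorithm

variable (𝔸 : Algorithm S A) [Nonempty A] [Fintype S] [Fintype A]
  [DiscreteMeasurableSpace S] [DiscreteMeasurableSpace A]
  (M M' : MDP S A) (ρ : Measure S) [IsProbabilityMeasure ρ]

/-- The test function is `l` times the indicator of the event; its exponential has mean `1 + p (exp
l - 1)`, where `p` is the probability of the event under `M'`. Intersecting with `τ ≤ T` makes the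
event readable from `T` rounds. -/
theorem mul_prob_le_log_add {E : Set (Traj S A)}
    (hE : MeasurableSet[𝔸.isStoppingTime.measurableSpace] E) (T : ℕ) {l : ℝ} (hl : 0 ≤ l) :
    l * (law M 𝔸.rule ρ).real (E ∩ {x | 𝔸.τ x ≤ T}) ≤
      Real.log (1 + (law M' 𝔸.rule ρ).real (E ∩ {x | 𝔸.τ x ≤ T}) * (Real.exp l - 1)) +
        (∑ u ∈ Finset.range T, ∑ z, 𝔸.visits M ρ u z * truncKL M M' l z).toReal := by
  obtain ⟨C, hC, hCE⟩ := 𝔸.exists_measurableSet_observed hE T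
  have hmem : ∀ x, observed T x ∈ C ↔ x ∈ E ∧ 𝔸.τ x ≤ T := Set.ext_iff.1 hCE
  have hreal : ∀ N : MDP S A, (histLaw N 𝔸.rule ρ T).real C =
      (law N 𝔸.rule ρ).real (E ∩ {x | 𝔸.τ x ≤ T}) := fun N => by
    rw [histLaw, map_measureReal_apply (measurable_observed T) hC, hCE]
  have key := 𝔸.integral_le_of_isStopped M M' ρ l T (C.indicator fun _ => l)
    (measurable_const.indicator hC) (fun h => Set.indicator_nonneg (fun _ _ => hl) h)
    (fun h => Set.indicator_le_self' (fun _ _ => hl) h) ?_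
  · rw [integral_indicator_const _ hC, hreal, smul_eq_mul, mul_comm] at key
    have hexp : ∀ h, Real.exp (C.indicator (fun _ => l) h) =
        1 + C.indicator (fun _ => Real.exp l - 1) h := fun h => by
      by_cases hh : h ∈ C <;> simp [hh]
    simp only [hexp] at key
    rw [integral_add (integrable_const _) ((integrable_const _).indicator hC),
      integral_indicator_const _ hC, hreal] at key
    simpa using key
  -- On `τ ≤ u`, membership in `E` is decided by the history of length `u`, because `E` lies in the
  -- σ-algebra of the stopping time.
  · intro x y u hu hx hxy
    have hy := 𝔸.le_of_observed_eq hxy hx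
    have hut : (u : WithTop ℕ) ≤ T := by exact_mod_cast hu
    obtain ⟨G, -, hG⟩ := 𝔸.exists_measurableSet_observed hE u
    have hmem' : ∀ x, observed u x ∈ G ↔ x ∈ E ∧ 𝔸.τ x ≤ u := Set.ext_iff.1 hG
    have hiff : observed T x ∈ C ↔ observed T y ∈ C := by
      rw [hmem, hmem, and_iff_left (hx.trans hut), and_iff_left (hy.trans hut),
        ← and_iff_left (a := x ∈ E) hx, ← and_iff_left (a := y ∈ E) hy, ← hmem', ← hmem', hxy]
    by_cases h : observed T x ∈ C
    · simp [h, hiff.1 h]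
    · simp [h, mt hiff.2 h]

/-- The expected number of times that the action of `z` is played in the state of `z`
before the algorithm stops. -/
def totalVisits (z : S × A) : ℝ≥0∞ := ∑' t, 𝔸.visits M ρ t z

omit [Nonempty A] [IsProbabilityMeasure ρ] [DiscreteMeasurableSpace S]
  [DiscreteMeasurableSpace A] in
theorem sum_totalVisits_mul (K : S × A → ℝ≥0∞) :
    ∑ z, 𝔸.totalVisits M ρ z * K z = ∑' t, ∑ z, 𝔸.visits M ρ t z * K z := by
  rw [Summable.tsum_finsetSum fun _ _ => ENNReal.summable]
  exact Finset.sum_congr rfl fun z _ => ENNReal.tsum_mul_right.symm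

/-- The transportation inequality for the events that are decided when the algorithm stops. -/
theorem mul_prob_le_log_add_information {E : Set (Traj S A)}
    (hE : MeasurableSet[𝔸.isStoppingTime.measurableSpace] E) {l b : ℝ} (hl : 0 ≤ l)
    (hb : (law M' 𝔸.rule ρ).real (E ∩ {x | 𝔸.τ x ≠ ⊤}) ≤ b)
    (hfin : ∑ z, 𝔸.totalVisits M ρ z * pairKL M M' z ≠ ∞) :
    l * (law M 𝔸.rule ρ).real (E ∩ {x | 𝔸.τ x ≠ ⊤}) ≤
      Real.log (1 + b * (Real.exp l - 1)) +
        (∑ z, 𝔸.totalVisits M ρ z * pairKL M M' z).toReal := by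
  have hexp : 0 ≤ Real.exp l - 1 := sub_nonneg.2 (Real.one_le_exp hl)
  have hmono : Monotone fun T : ℕ => E ∩ {x | 𝔸.τ x ≤ T} := fun T T' h x hx =>
    ⟨hx.1, le_trans hx.2 (show ((T : ℕ) : WithTop ℕ) ≤ T' by exact_mod_cast h)⟩
  have hunion : ⋃ T : ℕ, E ∩ {x | 𝔸.τ x ≤ T} = E ∩ {x | 𝔸.τ x ≠ ⊤} := by
    rw [← Set.inter_iUnion]
    congr 1
    ext x
    simp only [Set.mem_iUnion, Set.mem_ofPred_eq]
    constructor
    · rintro ⟨T, hT⟩ h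
      rw [h] at hT
      exact absurd hT (by simp)
    · intro h
      obtain ⟨T, hT⟩ := WithTop.ne_top_iff_exists.1 h
      exact ⟨T, hT.symm.le⟩
  have hlim : Tendsto (fun T : ℕ => l * (law M 𝔸.rule ρ).real (E ∩ {x | 𝔸.τ x ≤ T})) atTop
      (𝓝 (l * (law M 𝔸.rule ρ).real (E ∩ {x | 𝔸.τ x ≠ ⊤}))) := by
    refine Tendsto.const_mul l ((ENNReal.tendsto_toReal (measure_ne_top _ _)).comp ?_)
    rw [← hunion]
    exact tendsto_measure_iUnion_atTop hmono
  -- Only the left side goes to the limit. The right side is bounded uniformly in `T`, by dropping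
  -- the truncation and summing over all rounds.
  refine le_of_tendsto' hlim fun T => (𝔸.mul_prob_le_log_add M M' ρ hE T hl).trans ?_
  gcongr
  · refine (measureReal_mono ?_).trans hb
    rw [← hunion]
    exact Set.subset_iUnion (fun T : ℕ => E ∩ {x | 𝔸.τ x ≤ T}) T
  · rw [sum_totalVisits_mul]
    refine le_trans ?_ (ENNReal.sum_le_tsum (Finset.range T))
    gcongr
    exact min_le_left _ _

omit [IsProbabilityMeasure ρ] in
theorem visits_state (t : ℕ) (s : S) :
    ∑ a, 𝔸.visits M ρ t (s, a) =
      law M 𝔸.rule ρ {x | (t : WithTop ℕ) < 𝔸.τ x ∧ (x t).1 = s} := by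
  classical
  have h := 𝔸.lintegral_running M ρ t (fun z => if z.1 = s then 1 else 0)
  simp only [mul_one, mul_ite, mul_zero] at h
  rw [Fintype.sum_prod_type, Finset.sum_eq_single s] at h
  · simp only [if_true] at h
    have hs : MeasurableSet {h : Hist S A t | h.2 = s} := measurable_snd (.of_discrete (s := {s}))
    have h2 : ∀ h : Hist S A t, (if h.2 = s then 1 else 0 : ℝ≥0∞) =
        {h : Hist S A t | h.2 = s}.indicator 1 h := fun h => by
      by_cases hh : h.2 = s <;> simp [hh]
    simp only [h2, lintegral_const, measure_univ, mul_one] at h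
    rw [← h, lintegral_indicator_one hs, Measure.restrict_apply hs, histLaw,
      Measure.map_apply (measurable_observed t) (hs.inter (𝔸.stopped_spec t).1.compl)]
    congr 1
    ext x
    have h3 := (𝔸.observed_mem_stopped (t := t) (x := x)).not.trans not_le
    exact ⟨fun hx => ⟨h3.1 hx.2, hx.1⟩, fun hx => ⟨hx.2, h3.2 hx.1⟩⟩
  · intro s' _ hs'
    simp [hs']
  · simp

/-- Whether `t < τ` is known before round `t` is played, so conditioning on it does not bias the
transition that follows. -/
theorem visits_next_state (t : ℕ) (s : S) :
    ∑ z, 𝔸.visits M ρ t z * M.trans z {s} =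
      law M 𝔸.rule ρ {x | (t : WithTop ℕ) < 𝔸.τ x ∧ (x (t + 1)).1 = s} := by
  rw [← lintegral_running]
  set pre : Hist S A (t + 1) → Hist S A t := fun k =>
    (fun i => k.1 i.castSucc, (k.1 (Fin.last t)).1)
  have hpre : Measurable pre := by fun_prop
  have hpe : ∀ h p, pre (extend t (h, p)) = h := fun h p => by
    simp [pre, extend]
  have hpo : ∀ x : Traj S A, pre (observed (t + 1) x) = observed t x := fun x => rfl
  set D : Set (Hist S A (t + 1)) := pre ⁻¹' (𝔸.stopped t)ᶜ ∩ {k | k.2 = s}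
  have hD : MeasurableSet D := (hpre (𝔸.stopped_spec t).1.compl).inter
    (measurable_snd (.of_discrete (s := {s})))
  have h1 : law M 𝔸.rule ρ {x | (t : WithTop ℕ) < 𝔸.τ x ∧ (x (t + 1)).1 = s} =
      ∫⁻ k, D.indicator 1 k ∂histLaw M 𝔸.rule ρ (t + 1) := by
    rw [lintegral_indicator_one hD, histLaw, Measure.map_apply (measurable_observed _) hD]
    congr 1
    ext x
    simp only [D, Set.mem_ofPred_eq, Set.mem_preimage, Set.mem_inter_iff, hpo, Set.mem_compl_iff,
      observed_mem_stopped, not_le]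
    rfl
  rw [h1, histLaw_succ, Measure.lintegral_bind (by fun_prop)
    (measurable_one.indicator hD).aemeasurable, ← lintegral_indicator (𝔸.stopped_spec t).1.compl]
  refine lintegral_congr fun h => ?_
  rw [lintegral_histKernel _ _ _ _ (measurable_one.indicator hD)]
  by_cases hh : h ∈ 𝔸.stopped t
  · have : ∀ p, D.indicator (1 : Hist S A (t + 1) → ℝ≥0∞) (extend t (h, p)) = 0 := fun p =>
      Set.indicator_of_notMem (fun hm => hm.1 (by rwa [hpe])) _
    simp [this, hh]
  · have : ∀ a r s', D.indicator (1 : Hist S A (t + 1) → ℝ≥0∞) (extend t (h, a, r, s')) =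
        ({s} : Set S).indicator 1 s' := fun a r s' => by
      have : extend t (h, a, r, s') ∈ D ↔ s' = s := by
        simp only [D, Set.mem_inter_iff, Set.mem_preimage, hpe, Set.mem_compl_iff, hh,
          not_false_eq_true, true_and]
        rfl
      by_cases hs : s' = s
      · rw [Set.indicator_of_mem (this.2 hs)]; simp [hs]
      · rw [Set.indicator_of_notMem (this.not.2 hs)]; simp [hs]
    simp only [this]
    rw [Set.indicator_of_mem (s := (𝔸.stopped t)ᶜ) hh]
    simp [lintegral_indicator_one (MeasurableSet.of_discrete (s := {s}))]

/-- This is `E[τ] = ∑ P(t < τ)`; trajectories that never stop contribute `∞` on both sides. -/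
theorem sum_totalVisits : ∑ z, 𝔸.totalVisits M ρ z = expectedSamples M ρ 𝔸 := by
  have h := 𝔸.sum_totalVisits_mul M ρ (fun _ => 1)
  simp only [mul_one, 𝔸.sum_visits] at h
  have hm : ∀ t : ℕ, MeasurableSet {x | (t : WithTop ℕ) < 𝔸.τ x} := fun t => by
    have := (measurable_observed t (𝔸.stopped_spec t).1).compl
    rw [(𝔸.stopped_spec t).2] at this
    simpa [Set.compl_ofPred] using this
  rw [h, expectedSamples]
  simp_rw [← fun t => lintegral_indicator_one (μ := law M 𝔸.rule ρ) (hm t)]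
  rw [← lintegral_tsum fun t => (measurable_one.indicator (hm t)).aemeasurable]
  refine lintegral_congr fun x => ?_
  cases hx : 𝔸.τ x with
  | top =>
    simp only [Set.indicator, hx, Set.mem_ofPred_eq, WithTop.natCast_lt_top, if_true]
    simp
    rfl
  | coe n =>
    rw [tsum_eq_sum (s := Finset.range n)]
    · rw [Finset.sum_congr rfl (g := fun _ => (1 : ℝ≥0∞))]
      · simp
        rfl
      · intro t ht
        have : (t : WithTop ℕ) < n := by exact_mod_cast Finset.mem_range.1 ht
        simp [Set.indicator, hx, this]
    · intro t ht
      have : ¬ (t : WithTop ℕ) < n := by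
        rw [Finset.mem_range] at ht
        exact_mod_cast ht
      simp only [Set.indicator, hx, Set.mem_ofPred_eq]
      exact if_neg this

/-- A visit before stopping is either in round `0` or an arrival from an earlier round that also
precedes stopping. -/
theorem sum_totalVisits_state_le (s : S) :
    ∑ a, 𝔸.totalVisits M ρ (s, a) ≤ 1 + ∑ z, 𝔸.totalVisits M ρ z * M.trans z {s} := by
  rw [sum_totalVisits_mul]
  simp only [totalVisits]
  rw [← Summable.tsum_finsetSum fun _ _ => ENNReal.summable,
    tsum_eq_zero_add' ENNReal.summable]
  refine add_le_add ?_ (ENNReal.tsum_le_tsum fun t => ?_)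
  · rw [visits_state]
    exact prob_le_one
  · rw [visits_state, visits_next_state]
    refine measure_mono fun x hx => ⟨lt_trans ?_ hx.1, hx.2⟩
    exact_mod_cast t.lt_succ_self

/-- An arrival is followed by a counted visit unless the algorithm stops right there, which happens
at most once. -/
theorem sum_totalVisits_next_state_le (s : S) :
    ∑ z, 𝔸.totalVisits M ρ z * M.trans z {s} ≤ 1 + ∑ a, 𝔸.totalVisits M ρ (s, a) := by
  have hm : ∀ t : ℕ, MeasurableSet {x | 𝔸.τ x = (t + 1 : ℕ)} := fun t =>
    𝔸.isStoppingTime.measurableSpace_le _ (𝔸.isStoppingTime.measurableSet_eq' (t + 1))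
  have h1 : ∑' t : ℕ, law M 𝔸.rule ρ {x | 𝔸.τ x = (t + 1 : ℕ)} ≤ 1 := by
    rw [← measure_iUnion _ hm]
    · exact prob_le_one
    · intro t u htu
      refine Set.disjoint_left.2 fun x hx hx' => htu ?_
      have : ((t + 1 : ℕ) : WithTop ℕ) = (u + 1 : ℕ) := hx.symm.trans hx'
      simpa using this
  rw [sum_totalVisits_mul]
  simp only [totalVisits]
  rw [← Summable.tsum_finsetSum fun _ _ => ENNReal.summable]
  calc ∑' t, ∑ z, 𝔸.visits M ρ t z * M.trans z {s}
      ≤ ∑' t : ℕ, (law M 𝔸.rule ρ {x | 𝔸.τ x = (t + 1 : ℕ)} +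
          ∑ a, 𝔸.visits M ρ (t + 1) (s, a)) := by
        refine ENNReal.tsum_le_tsum fun t => ?_
        rw [visits_state, visits_next_state]
        refine (measure_mono fun x hx => ?_).trans (measure_union_le _ _)
        have h2 : ((t + 1 : ℕ) : WithTop ℕ) ≤ 𝔸.τ x := by
          exact ENat.add_one_le_iff (ENat.natCast_ne_top t) |>.2 hx.1
        rcases h2.eq_or_lt with h | h
        · exact Or.inl h.symm
        · exact Or.inr ⟨h, hx.2⟩
    _ = ∑' t : ℕ, law M 𝔸.rule ρ {x | 𝔸.τ x = (t + 1 : ℕ)} +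
          ∑' t : ℕ, ∑ a, 𝔸.visits M ρ (t + 1) (s, a) := ENNReal.tsum_add
    _ ≤ _ := add_le_add h1 (ENNReal.tsum_comp_le_tsum_of_injective (add_left_injective 1)
          fun t => ∑ a, 𝔸.visits M ρ t (s, a))

end Algorithm

end

/-! ### The lower bound at fixed confidence. -/

section

theorem binaryKL_one_sub (δ : ℝ) :
    binaryKL δ (1 - δ) = (1 - 2 * δ) * Real.log ((1 - δ) / δ) := by
  have : Real.log (δ / (1 - δ)) = -Real.log ((1 - δ) / δ) := by
    rw [← Real.log_inv, inv_div]
  rw [binaryKL, sub_sub_cancel, this]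
  ring

variable {S A : Type*} [MeasurableSpace S] [MeasurableSpace A]

namespace Algorithm

variable (𝔸 : Algorithm S A) [Nonempty A] [Fintype S] [Fintype A]
  [DiscreteMeasurableSpace S] [DiscreteMeasurableSpace A]
  (M M' : MDP S A) (ρ : Measure S) [IsProbabilityMeasure ρ]

theorem binaryKL_le_information {γ δ : ℝ} {𝓜 : Set (MDP S A)} (hM : M ∈ 𝓜) (h0 : 0 < δ)
    (h1 : δ ≤ 1 / 2) (hPC : IsPC γ ρ 𝓜 δ 𝔸) (hτ : expectedSamples M ρ 𝔸 ≠ ∞)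
    (hM' : M' ∈ Alt γ 𝓜 M) :
    ENNReal.ofReal (binaryKL δ (1 - δ)) ≤ ∑ z, 𝔸.totalVisits M ρ z * pairKL M M' z := by
  by_cases hfin : ∑ z, 𝔸.totalVisits M ρ z * pairKL M M' z = ∞
  · rw [hfin]; exact le_top
  set E : Set (Traj S A) := 𝔸.decision ⁻¹' optimalPolicies γ M
  have hE : MeasurableSet[𝔸.isStoppingTime.measurableSpace] E :=
    𝔸.measurable_decision (Set.toFinite _).measurableSet
  have hb : (law M' 𝔸.rule ρ).real (E ∩ {x | 𝔸.τ x ≠ ⊤}) ≤ δ := by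
    refine ENNReal.toReal_le_of_le_ofReal h0.le ((measure_mono ?_).trans (hPC M' hM'.1))
    exact fun x hx => ⟨hx.2, Set.disjoint_left.1 hM'.2.2 hx.1⟩
  -- `IsPC` alone does not force stopping. But the probability of never stopping bounds the expected
  -- visits of every round from below, so it vanishes when `E[τ]` is finite.
  have hnever : law M 𝔸.rule ρ {x | 𝔸.τ x = ⊤} = 0 := by
    have hlt : ∀ t : ℕ, law M 𝔸.rule ρ {x | 𝔸.τ x = ⊤} ≤ ∑ z, 𝔸.visits M ρ t z := fun t => by
      rw [𝔸.sum_visits]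
      refine measure_mono fun x (hx : 𝔸.τ x = ⊤) => ?_
      simp [hx]
    by_contra hne
    refine hτ ?_
    rw [← sum_totalVisits, ← top_le_iff, ← ENNReal.tsum_const_eq_top_of_ne_zero (α := ℕ) hne]
    have := 𝔸.sum_totalVisits_mul M ρ (fun _ => 1)
    simp only [mul_one] at this
    rw [this]
    exact ENNReal.tsum_le_tsum hlt
  have ha : 1 - δ ≤ (law M 𝔸.rule ρ).real (E ∩ {x | 𝔸.τ x ≠ ⊤}) := by
    have h2 : (law M 𝔸.rule ρ).real {x | 𝔸.τ x ≠ ⊤ ∧ 𝔸.decision x ∉ optimalPolicies γ M} ≤ δ :=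
      ENNReal.toReal_le_of_le_ofReal h0.le (hPC M hM)
    have h3 : (law M 𝔸.rule ρ).real {x | 𝔸.τ x = ⊤} = 0 := by simp [Measure.real, hnever]
    have h4 : (Set.univ : Set (Traj S A)) ⊆ (E ∩ {x | 𝔸.τ x ≠ ⊤}) ∪
        ({x | 𝔸.τ x ≠ ⊤ ∧ 𝔸.decision x ∉ optimalPolicies γ M} ∪ {x | 𝔸.τ x = ⊤}) := by
      intro x _
      by_cases hx : 𝔸.τ x = ⊤
      · exact Or.inr (Or.inr hx)
      · by_cases hd : 𝔸.decision x ∈ optimalPolicies γ M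
        · exact Or.inl ⟨hd, hx⟩
        · exact Or.inr (Or.inl ⟨hx, hd⟩)
    have h5 := (measureReal_mono (μ := law M 𝔸.rule ρ) h4).trans ((measureReal_union_le _ _).trans
      (add_le_add_right (measureReal_union_le _ _) _))
    rw [probReal_univ, h3] at h5
    linarith
  have hδ : 0 < 1 - δ := by linarith
  have hr : 1 ≤ (1 - δ) / δ := by rw [le_div_iff₀ h0]; linarith
  have hL : 0 ≤ Real.log ((1 - δ) / δ) := Real.log_nonneg hr
  -- This `l` maximizes `l (1 - δ) - log (1 + δ (exp l - 1))`, with maximum `kl(δ, 1 - δ)`; it is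
  -- nonnegative because `δ ≤ 1 / 2`.
  have key := 𝔸.mul_prob_le_log_add_information M M' ρ hE (l := 2 * Real.log ((1 - δ) / δ))
    (by positivity) hb hfin
  have hexp : Real.exp (2 * Real.log ((1 - δ) / δ)) = ((1 - δ) / δ) ^ 2 := by
    rw [two_mul, Real.exp_add, Real.exp_log (by positivity), sq]
  have harg : 1 + δ * (((1 - δ) / δ) ^ 2 - 1) = (1 - δ) / δ := by
    field_simp
    ring
  rw [hexp, harg] at key
  refine ENNReal.ofReal_le_of_le_toReal ?_
  rw [binaryKL_one_sub]
  nlinarith [mul_le_mul_of_nonneg_left ha hL]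

end Algorithm

theorem boundAt_le_expectedSamples [Nonempty A] [Fintype S] [Fintype A]
    [DiscreteMeasurableSpace S] [DiscreteMeasurableSpace A] (𝔸 : Algorithm S A) (M : MDP S A)
    (ρ : Measure S) [IsProbabilityMeasure ρ] {γ δ : ℝ} {𝓜 : Set (MDP S A)} (hM : M ∈ 𝓜)
    (h0 : 0 < δ) (h1 : δ ≤ 1 / 2) (hPC : IsPC γ ρ 𝓜 δ 𝔸) :
    boundAt γ 𝓜 M δ ≤ expectedSamples M ρ 𝔸 := by
  by_cases hτ : expectedSamples M ρ 𝔸 = ∞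
  · rw [hτ]; exact le_top
  have hfin : ∀ z, 𝔸.totalVisits M ρ z ≠ ∞ := by
    rw [← 𝔸.sum_totalVisits] at hτ
    exact fun z => (ENNReal.sum_ne_top.1 hτ) z (Finset.mem_univ z)
  set n : S × A → ℝ≥0 := fun z => (𝔸.totalVisits M ρ z).toNNReal
  have hn : ∀ z, (n z : ℝ≥0∞) = 𝔸.totalVisits M ρ z := fun z => ENNReal.coe_toNNReal (hfin z)
  have hflow : ∀ s, |netFlow M n s| ≤ 1 := fun s => by
    have hA : (∑ a, 𝔸.totalVisits M ρ (s, a)).toReal = ∑ a, (n (s, a) : ℝ) :=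
      ENNReal.toReal_sum fun a _ => hfin _
    have hB : (∑ z, 𝔸.totalVisits M ρ z * M.trans z {s}).toReal =
        ∑ z, (M.trans z).real {s} * n z := by
      rw [ENNReal.toReal_sum fun z _ => ENNReal.mul_ne_top (hfin z) (measure_ne_top _ _)]
      exact Finset.sum_congr rfl fun z _ => by rw [ENNReal.toReal_mul, mul_comm]; rfl
    have hAt : ∑ a, 𝔸.totalVisits M ρ (s, a) ≠ ∞ := ENNReal.sum_ne_top.2 fun a _ => hfin _
    have hBt : ∑ z, 𝔸.totalVisits M ρ z * M.trans z {s} ≠ ∞ :=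
      ENNReal.sum_ne_top.2 fun z _ => ENNReal.mul_ne_top (hfin z) (measure_ne_top _ _)
    have h2 := ENNReal.toReal_mono (ENNReal.add_ne_top.2 ⟨ENNReal.one_ne_top, hBt⟩)
      (𝔸.sum_totalVisits_state_le M ρ s)
    have h3 := ENNReal.toReal_mono (ENNReal.add_ne_top.2 ⟨ENNReal.one_ne_top, hAt⟩)
      (𝔸.sum_totalVisits_next_state_le M ρ s)
    rw [ENNReal.toReal_add ENNReal.one_ne_top hBt, hA, hB, ENNReal.toReal_one] at h2
    rw [ENNReal.toReal_add ENNReal.one_ne_top hAt, hA, hB, ENNReal.toReal_one] at h3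
    rw [netFlow, abs_le]
    constructor <;> linarith
  have hinfo : ∀ M' ∈ Alt γ 𝓜 M, ENNReal.ofReal (binaryKL δ (1 - δ)) ≤ information M M' n :=
    fun M' hM' => by
      simpa only [information, hn] using
        𝔸.binaryKL_le_information M M' ρ hM h0 h1 hPC hτ hM'
  refine (iInf₂_le n ⟨hflow, hinfo⟩).trans_eq ?_
  simp only [hn, 𝔸.sum_totalVisits]

end

/-! ### Balanced allocations and the repair of net flows. -/

section

variable {S A : Type*} [MeasurableSpace S] [MeasurableSpace A] [Fintype S] [Fintype A]

section LinearAlgebra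

variable (M : MDP S A)

theorem netFlow_add (m n : S × A → ℝ≥0) (s : S) :
    netFlow M (m + n) s = netFlow M m s + netFlow M n s := by
  simp only [netFlow, Pi.add_apply, NNReal.coe_add, mul_add, Finset.sum_add_distrib]
  ring

theorem netFlow_smul (c : ℝ≥0) (n : S × A → ℝ≥0) (s : S) :
    netFlow M (c • n) s = c * netFlow M n s := by
  simp only [netFlow, Pi.smul_apply, smul_eq_mul, NNReal.coe_mul, mul_sub, Finset.mul_sum]
  congr 1
  exact Finset.sum_congr rfl fun z _ => by ring

theorem netFlow_sum {ι : Type*} (I : Finset ι) (f : ι → S × A → ℝ≥0) (s : S) :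
    netFlow M (∑ i ∈ I, f i) s = ∑ i ∈ I, netFlow M (f i) s := by
  classical
  induction I using Finset.induction_on with
  | empty => simp [netFlow]
  | insert i I hi ih => rw [Finset.sum_insert hi, Finset.sum_insert hi, netFlow_add, ih]

theorem information_add (M' : MDP S A) (m n : S × A → ℝ≥0) :
    information M M' (m + n) = information M M' m + information M M' n := by
  simp [information, add_mul, Finset.sum_add_distrib]

theorem information_smul (M' : MDP S A) (c : ℝ≥0) (n : S × A → ℝ≥0) :
    information M M' (c • n) = c * information M M' n := by
  simp [information, Finset.mul_sum, mul_assoc]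

variable [DiscreteMeasurableSpace S]

omit [Fintype A] in
theorem sum_trans_real (z : S × A) : ∑ s, (M.trans z).real {s} = 1 := by
  simp [sum_measureReal_singleton]

theorem sum_netFlow (n : S × A → ℝ≥0) : ∑ s, netFlow M n s = 0 := by
  have h : ∑ s, ∑ z, (M.trans z).real {s} * n z = ∑ z, (n z : ℝ) := by
    rw [Finset.sum_comm]
    exact Finset.sum_congr rfl fun z _ => by rw [← Finset.sum_mul, sum_trans_real, one_mul]
  simp only [netFlow, Finset.sum_sub_distrib]
  rw [h, Fintype.sum_prod_type, sub_self]

/-- The transition matrix under the policy that plays all actions with the same probability. -/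
def uniformTrans : Matrix S S ℝ :=
  fun u v => (Fintype.card A : ℝ)⁻¹ * ∑ a, (M.trans (u, a)).real {v}

omit [Fintype S] [DiscreteMeasurableSpace S] in
theorem uniformTrans_nonneg (u v : S) : 0 ≤ uniformTrans M u v :=
  mul_nonneg (by positivity) (Finset.sum_nonneg fun _ _ => measureReal_nonneg)

/-- The allocation that spreads the number of visits of each state over all actions. -/
def spread (A : Type*) [Fintype A] (x : S → ℝ≥0) : S × A → ℝ≥0 :=
  fun z => (Fintype.card A : ℝ≥0)⁻¹ * x z.1

variable [Nonempty A]

theorem sum_uniformTrans (u : S) : ∑ v, uniformTrans M u v = 1 := by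
  simp only [uniformTrans]
  rw [← Finset.mul_sum, Finset.sum_comm, Finset.sum_congr rfl fun a _ => sum_trans_real M (u, a)]
  simp

omit [MeasurableSpace S] [MeasurableSpace A] [Fintype S] [DiscreteMeasurableSpace S] in
theorem sum_spread (x : S → ℝ≥0) (u : S) : ∑ a : A, spread A x (u, a) = x u := by
  simp [spread]

omit [DiscreteMeasurableSpace S] in
theorem netFlow_spread (x : S → ℝ≥0) (v : S) :
    netFlow M (spread A x) v = x v - ∑ u, uniformTrans M u v * x u := by
  rw [netFlow, ← NNReal.coe_sum, sum_spread, Fintype.sum_prod_type]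
  congr 1
  refine Finset.sum_congr rfl fun u _ => ?_
  simp only [spread, uniformTrans, NNReal.coe_mul, NNReal.coe_inv, NNReal.coe_natCast]
  rw [← Finset.sum_mul]
  ring

/-- The uniform policy has a stationary distribution. As `P` fixes the constant vector, it has a
nonzero left fixed vector `x`. Then `|x| ≤ |x| P` entrywise with equal total mass, so `|x|` is fixed
too and can be normalized. -/
theorem allocations_nonempty [Nonempty S] : (allocations M).Nonempty := by
  classical
  set P := uniformTrans M
  have hdet : (1 - P).det = 0 := by
    rw [← Matrix.exists_mulVec_eq_zero_iff]
    refine ⟨1, one_ne_zero, ?_⟩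
    rw [Matrix.sub_mulVec, Matrix.one_mulVec, sub_eq_zero]
    ext u
    simp [Matrix.mulVec, dotProduct, P, sum_uniformTrans]
  obtain ⟨x, hx0, hx⟩ := Matrix.exists_vecMul_eq_zero_iff.2 hdet
  have hfix : ∀ v, x v = ∑ u, x u * P u v := fun v => by
    have := congrFun hx v
    simp only [Matrix.vecMul_sub, Matrix.vecMul_one, Pi.sub_apply, Pi.zero_apply] at this
    exact sub_eq_zero.1 this
  have hle : ∀ v, |x v| ≤ ∑ u, |x u| * P u v := fun v => by
    rw [hfix v]
    refine (Finset.abs_sum_le_sum_abs _ _).trans_eq (Finset.sum_congr rfl fun u _ => ?_)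
    rw [abs_mul, abs_of_nonneg (uniformTrans_nonneg M u v)]
  have hsum : ∑ v, |x v| = ∑ v, ∑ u, |x u| * P u v := by
    rw [Finset.sum_comm]
    exact Finset.sum_congr rfl fun u _ => by rw [← Finset.mul_sum, sum_uniformTrans, mul_one]
  have heq : ∀ v, |x v| = ∑ u, |x u| * P u v := fun v =>
    (Finset.sum_eq_sum_iff_of_le fun v _ => hle v).1 hsum v (Finset.mem_univ v)
  set y : S → ℝ≥0 := fun v => ‖x v‖₊
  have hy0 : ∑ v, y v ≠ 0 := fun h => hx0 <| funext fun v => by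
    simpa [y] using (Finset.sum_eq_zero_iff.1 h) v (Finset.mem_univ v)
  refine ⟨(∑ v, y v)⁻¹ • spread A y, ?_, fun v => ?_⟩
  · simp only [Pi.smul_apply, smul_eq_mul]
    rw [← Finset.mul_sum, Fintype.sum_prod_type, Finset.sum_congr rfl fun u _ => sum_spread y u,
      inv_mul_cancel₀ hy0]
  · rw [netFlow_smul, netFlow_spread]
    have : (y v : ℝ) = ∑ u, uniformTrans M u v * y u := by
      simpa [y, mul_comm, P] using heq v
    rw [this, sub_self, mul_zero]

omit [Fintype S] [Nonempty A] [DiscreteMeasurableSpace S] in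
theorem uniformTrans_pos {u v : S} {a : A} (h : M.trans (u, a) {v} ≠ 0) :
    0 < uniformTrans M u v := by
  have : Nonempty A := ⟨a⟩
  refine mul_pos (by positivity) (Finset.sum_pos' (fun _ _ => measureReal_nonneg)
    ⟨a, Finset.mem_univ a, ?_⟩)
  exact ENNReal.toReal_pos h (measure_ne_top _ _)

/-- In a communicating MDP a unit of flow can be sent from any state to any other state. -/
theorem exists_netFlow_eq [DecidableEq S] (hM : Communicating M) (s s' : S) :
    ∃ c : S × A → ℝ≥0, ∀ v, netFlow M c v = (if v = s then 1 else 0) - (if v = s' then 1 else 0) := by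
  set P := uniformTrans M
  -- The identity minus the uniform chain killed at `s'`. Its inverse counts expected visits before
  -- `s'` is reached.
  set B : Matrix S S ℝ := 1 - Matrix.of fun u v => if u = s' ∨ v = s' then 0 else P u v
  have hmul : ∀ y u, (B.mulVec y) u = y u - ∑ v, (if u = s' ∨ v = s' then 0 else P u v) * y v :=
    fun y u => by rw [Matrix.sub_mulVec, Matrix.one_mulVec]; rfl
  -- Minimum principle. A negative minimum is not attained at `s'` and spreads to every possible
  -- successor, the erased column acting as the value `0` at `s'`. A path to `s'` then gives a
  -- contradiction.
  have hmono : ∀ y : S → ℝ, (∀ u, 0 ≤ (B.mulVec y) u) → ∀ u, 0 ≤ y u := by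
    intro y hy
    have : Nonempty S := ⟨s⟩
    obtain ⟨u₁, hu₁⟩ := Finite.exists_min y
    by_contra! hneg
    obtain ⟨u₀, hu₀⟩ := hneg
    have hm : y u₁ < 0 := (hu₁ u₀).trans_lt hu₀
    have hmin : ∀ u, y u = y u₁ → u ≠ s' ∧ ∀ v, 0 < P u v → y v = y u₁ := by
      intro u hu
      have hBu := hy u
      rw [hmul] at hBu
      have hus : u ≠ s' := by
        rintro rfl
        simp only [true_or, if_true, zero_mul, Finset.sum_const_zero] at hBu
        linarith
      refine ⟨hus, fun v hv => ?_⟩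
      have hterm : ∀ w, 0 ≤ P u w * ((if w = s' then 0 else y w) - y u₁) := fun w => by
        refine mul_nonneg (uniformTrans_nonneg M u w) ?_
        split_ifs
        · linarith
        · linarith [hu₁ w]
      have hsum : ∑ w, P u w * ((if w = s' then 0 else y w) - y u₁) ≤ 0 := by
        simp only [mul_sub, Finset.sum_sub_distrib]
        rw [← Finset.sum_mul, sum_uniformTrans, one_mul, ← hu]
        refine (le_of_eq ?_).trans (neg_nonpos.2 hBu)
        rw [neg_sub]
        congr 1
        refine Finset.sum_congr rfl fun w _ => ?_
        by_cases hw : w = s' <;> simp [hus, hw]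
      have hz := (Finset.sum_eq_zero_iff_of_nonneg fun w _ => hterm w).1
        (le_antisymm hsum (Finset.sum_nonneg fun w _ => hterm w)) v (Finset.mem_univ v)
      rcases mul_eq_zero.1 hz with h | h
      · exact absurd h hv.ne'
      · by_cases hvs : v = s'
        · rw [if_pos hvs] at h
          linarith
        · rw [if_neg hvs] at h
          linarith
    obtain ⟨π, hπ⟩ := hM u₁ s'
    have hreach : ∀ v, Relation.TransGen (fun u v => M.trans (u, π u) {v} ≠ 0) u₁ v →
        y v = y u₁ := by
      intro v hv
      induction hv with
      | single h => exact (hmin u₁ rfl).2 _ (uniformTrans_pos M h)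
      | tail _ h ih => exact (hmin _ ih).2 _ (uniformTrans_pos M h)
    exact (hmin s' (hreach s' hπ)).1 rfl
  -- Applied to both differences of two vectors with the same image, the minimum principle gives
  -- injectivity.
  have hunit : IsUnit B := by
    rw [← Matrix.mulVec_injective_iff_isUnit]
    intro y z hyz
    have h1 := hmono (y - z) fun u => by
      rw [Matrix.mulVec_sub, sub_eq_zero.2 hyz]; simp
    have h2 := hmono (z - y) fun u => by
      rw [Matrix.mulVec_sub, sub_eq_zero.2 hyz.symm]; simp
    ext u
    have h1 := h1 u
    have h2 := h2 u
    simp only [Pi.sub_apply] at h1 h2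
    linarith
  obtain ⟨D, hBD, hDB⟩ : ∃ D, B * D = 1 ∧ D * B = 1 :=
    ⟨_, hunit.mul_val_inv, hunit.val_inv_mul⟩
  have hpos : ∀ v, 0 ≤ D s v := fun v => by
    have := hmono (D.mulVec (Pi.single v 1)) (fun u => by
      rw [Matrix.mulVec_mulVec, hBD, Matrix.one_mulVec]
      by_cases h : u = v
      · simp [h]
      · simp [h]) s
    simpa using this
  set x : S → ℝ≥0 := fun u => if u = s' then 0 else ⟨D s u, hpos u⟩
  have hxv : ∀ v, v ≠ s' → (x v : ℝ) = D s v := fun v hv => by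
    have : x v = ⟨D s v, hpos v⟩ := if_neg hv
    rw [this]; rfl
  have hflow : ∀ v, v ≠ s' → netFlow M (spread A x) v = if v = s then 1 else 0 := by
    intro v hv
    have h1 := congrFun (congrFun hDB s) v
    rw [Matrix.mul_apply] at h1
    have h2 : ∑ u, D s u * B u v = x v - ∑ u, P u v * x u := by
      simp only [B, Matrix.sub_apply, mul_sub, Finset.sum_sub_distrib, Matrix.of_apply]
      congr 1
      · simp [Matrix.one_apply, hxv v hv]
      · refine Finset.sum_congr rfl fun u _ => ?_
        by_cases hu : u = s'
        · simp [x, hu]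
        · simp [hv, hu, hxv u hu, mul_comm]
    rw [netFlow_spread, ← h2, h1, Matrix.one_apply]
    simp [eq_comm]
  refine ⟨spread A x, fun v => ?_⟩
  -- At `s'` the equations of `B` say nothing; the value there is forced because net flows sum to
  -- zero.
  by_cases hv : v = s'
  · have h1 := sum_netFlow M (spread A x)
    rw [← Finset.add_sum_erase _ _ (Finset.mem_univ s'),
      Finset.sum_congr rfl fun w hw => hflow w (Finset.ne_of_mem_erase hw)] at h1
    subst hv
    by_cases hs : v = s
    · subst hs
      simp at h1
      simp [h1]
    · rw [Finset.sum_ite_eq' , if_pos (by simp [Ne.symm hs])] at h1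
      simp [hs]
      linarith
  · rw [hflow v hv]
    simp [hv]

end LinearAlgebra

/-- In a communicating MDP a bounded correction restores the balance of an allocation whose net
flows are bounded by one. -/
theorem exists_balanced [DiscreteMeasurableSpace S] [Nonempty S] [Nonempty A] (M : MDP S A)
    (hM : Communicating M) :
    ∃ C : ℝ≥0, ∀ n : S × A → ℝ≥0, (∀ s, |netFlow M n s| ≤ 1) →
      ∃ c : S × A → ℝ≥0, (∀ s, netFlow M (n + c) s = 0) ∧ ∑ z, c z ≤ C := by
  classical
  obtain ⟨s₀⟩ := ‹Nonempty S›
  choose f hf using fun s => exists_netFlow_eq M hM s s₀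
  choose g hg using fun s => exists_netFlow_eq M hM s₀ s
  refine ⟨∑ s, ∑ z, (f s z + g s z), fun n hn => ?_⟩
  -- All corrections pass through the hub `s₀`: a state with positive net flow lacks arrivals and is
  -- supplied from it, one with negative net flow is drained into it. The hub balances since net
  -- flows sum to zero.
  refine ⟨∑ s, ((-netFlow M n s).toNNReal • f s + (netFlow M n s).toNNReal • g s), fun v => ?_, ?_⟩
  · have hterm : ∀ s, netFlow M
        ((-netFlow M n s).toNNReal • f s + (netFlow M n s).toNNReal • g s) v =
        (if v = s₀ then netFlow M n s else 0) - (if v = s then netFlow M n s else 0) := fun s => by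
      rw [netFlow_add, netFlow_smul, netFlow_smul, hf, hg]
      simp only [Real.coe_toNNReal']
      rcases le_total 0 (netFlow M n s) with h | h
      · rw [max_eq_left h, max_eq_right (neg_nonpos.2 h)]
        split_ifs <;> ring
      · rw [max_eq_right h, max_eq_left (neg_nonneg.2 h)]
        split_ifs <;> ring
    rw [netFlow_add, netFlow_sum, Finset.sum_congr rfl fun s _ => hterm s, Finset.sum_sub_distrib]
    by_cases hv : v = s₀
    · simp [hv, sum_netFlow]
    · simp [hv]
  · have hle : ∀ s, (-netFlow M n s).toNNReal ≤ 1 ∧ (netFlow M n s).toNNReal ≤ 1 := fun s => by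
      have := abs_le.1 (hn s)
      constructor <;> rw [Real.toNNReal_le_one] <;> linarith
    simp only [Finset.sum_apply, Pi.add_apply, Pi.smul_apply, smul_eq_mul]
    rw [Finset.sum_comm]
    refine Finset.sum_le_sum fun s _ => Finset.sum_le_sum fun z _ => ?_
    exact add_le_add (mul_le_of_le_one_left zero_le (hle s).1)
      (mul_le_of_le_one_left zero_le (hle s).2)

end

/-! ### The limit of small `δ` and the dual formula. -/

section

theorem tendsto_log_one_div : Tendsto (fun δ : ℝ => Real.log (1 / δ)) (𝓝[>] 0) atTop := by
  simp only [one_div, Real.log_inv]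
  exact tendsto_neg_atBot_atTop.comp Real.tendsto_log_nhdsGT_zero

theorem tendsto_binaryKL_div_log :
    Tendsto (fun δ : ℝ => binaryKL δ (1 - δ) / Real.log (1 / δ)) (𝓝[>] 0) (𝓝 1) := by
  have hlog := tendsto_log_one_div
  have hid : Tendsto (fun δ : ℝ => δ) (𝓝[>] 0) (𝓝 0) := tendsto_nhdsWithin_of_tendsto_nhds tendsto_id
  have h1 : Tendsto (fun δ : ℝ => Real.log (1 - δ)) (𝓝[>] 0) (𝓝 0) := by
    have : Tendsto (fun δ : ℝ => 1 - δ) (𝓝[>] 0) (𝓝 1) := by simpa using hid.const_sub 1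
    simpa using this.log one_ne_zero
  have h2 : Tendsto (fun δ : ℝ => (1 - 2 * δ) * (Real.log (1 - δ) / Real.log (1 / δ) + 1))
      (𝓝[>] 0) (𝓝 1) := by
    simpa using ((hid.const_mul 2).const_sub 1).mul ((h1.div_atTop hlog).add_const 1)
  refine h2.congr' ?_
  filter_upwards [Ioo_mem_nhdsGT (zero_lt_one (α := ℝ)), hlog.eventually_gt_atTop 0] with δ hδ hL
  rw [binaryKL_one_sub, Real.log_div (sub_pos.2 hδ.2).ne' hδ.1.ne', sub_eq_add_neg (Real.log _),
    ← Real.log_inv, ← one_div, mul_div_assoc, add_div, div_self hL.ne']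

variable {S A : Type*} [MeasurableSpace S] [MeasurableSpace A] [Fintype S] [Fintype A]
  [DiscreteMeasurableSpace S] [Nonempty S] [Nonempty A]
  (γ : ℝ) (𝓜 : Set (MDP S A)) (M : MDP S A)

omit [Nonempty S] [Nonempty A] in
/-- A balanced allocation of information at least `k` yields, after scaling, an upper bound on the
asymptotic value. -/
theorem asymptoticBound_mul_le (n : S × A → ℝ≥0) (hn : ∀ s, netFlow M n s = 0) {k : ℝ≥0}
    (hk : k ≠ 0) (hinfo : ∀ M' ∈ Alt γ 𝓜 M, (k : ℝ≥0∞) ≤ information M M' n) :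
    asymptoticBound γ 𝓜 M ≤ (k : ℝ≥0∞)⁻¹ * ∑ z, (n z : ℝ≥0∞) := by
  have hk' : (k : ℝ≥0∞) ≠ 0 := ENNReal.coe_ne_zero.2 hk
  have hflow : ∀ s, netFlow M (k⁻¹ • n) s = 0 := fun s => by rw [netFlow_smul, hn, mul_zero]
  have hinfo' : ∀ M' ∈ Alt γ 𝓜 M, 1 ≤ information M M' (k⁻¹ • n) := fun M' hM' => by
    rw [information_smul, ENNReal.coe_inv hk, ← ENNReal.inv_mul_cancel hk' ENNReal.coe_ne_top]
    gcongr
    exact hinfo M' hM'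
  refine (iInf₂_le (k⁻¹ • n) ⟨hflow, hinfo'⟩).trans_eq ?_
  rw [Finset.mul_sum]
  exact Finset.sum_congr rfl fun z _ => by
    rw [Pi.smul_apply, smul_eq_mul, ENNReal.coe_mul, ENNReal.coe_inv hk]

/-- The repair adds mass at most `C` and cannot reduce information, so a repaired allocation is
feasible for the asymptotic problem after scaling. -/
theorem exists_asymptoticBound_mul_le (hM : Communicating M) :
    ∃ C : ℝ≥0, ∀ δ : ℝ, asymptoticBound γ 𝓜 M * ENNReal.ofReal (binaryKL δ (1 - δ)) ≤
      boundAt γ 𝓜 M δ + C := by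
  obtain ⟨C, hC⟩ := exists_balanced M hM
  refine ⟨C, fun δ => ?_⟩
  rw [← tsub_le_iff_right]
  refine le_iInf₂ fun n hn => ?_
  rw [tsub_le_iff_right]
  obtain ⟨c, hc, hcC⟩ := hC n hn.1
  by_cases hk : (binaryKL δ (1 - δ)).toNNReal = 0
  · simp [ENNReal.ofReal, hk]
  have h := asymptoticBound_mul_le γ 𝓜 M (n + c) hc hk fun M' hM' =>
    (hn.2 M' hM').trans (by rw [information_add]; exact le_self_add)
  rw [mul_comm]
  refine (mul_le_mul_right h (ENNReal.ofReal (binaryKL δ (1 - δ)))).trans ?_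
  rw [ENNReal.ofReal, ← mul_assoc, ENNReal.mul_inv_cancel (ENNReal.coe_ne_zero.2 hk)
    ENNReal.coe_ne_top, one_mul]
  simp only [Pi.add_apply, ENNReal.coe_add, Finset.sum_add_distrib]
  gcongr
  exact_mod_cast hcC

theorem asymptoticBound_le_liminf [DiscreteMeasurableSpace A] (ρ : Measure S)
    [IsProbabilityMeasure ρ] (hMem : M ∈ 𝓜) (𝔸 : ℝ → Algorithm S A) (hM : Communicating M)
    (hPC : ∀ δ ∈ Set.Ioo (0 : ℝ) 1, IsPC γ ρ 𝓜 δ (𝔸 δ)) :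
    asymptoticBound γ 𝓜 M ≤ liminf (fun δ : ℝ =>
      expectedSamples M ρ (𝔸 δ) / ENNReal.ofReal (Real.log (1 / δ))) (𝓝[>] 0) := by
  obtain ⟨C, hC⟩ := exists_asymptoticBound_mul_le γ 𝓜 M hM
  set T := asymptoticBound γ 𝓜 M
  have hlog := tendsto_log_one_div
  -- The value `T` may be `∞`; the product still converges because the other factor tends to `1 ≠
  -- 0`.
  have h1 : Tendsto (fun δ : ℝ => T * ENNReal.ofReal (binaryKL δ (1 - δ) / Real.log (1 / δ)))
      (𝓝[>] 0) (𝓝 T) := by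
    have := ENNReal.Tendsto.const_mul (a := T) (ENNReal.tendsto_ofReal tendsto_binaryKL_div_log)
      (Or.inl (by simp))
    simpa using this
  have h2 : Tendsto (fun δ : ℝ => (C : ℝ≥0∞) / ENNReal.ofReal (Real.log (1 / δ)))
      (𝓝[>] 0) (𝓝 0) := by
    have := ENNReal.Tendsto.const_div (a := (C : ℝ≥0∞)) (ENNReal.tendsto_ofReal_atTop.comp hlog)
      (Or.inr ENNReal.coe_ne_top)
    simpa using this
  have h3 := ENNReal.Tendsto.sub h1 h2 (Or.inr ENNReal.zero_ne_top)
  rw [tsub_zero] at h3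
  rw [← h3.liminf_eq]
  refine liminf_le_liminf ?_
  filter_upwards [Ioo_mem_nhdsGT (show (0 : ℝ) < 1 / 2 by norm_num),
    hlog.eventually_gt_atTop 0] with δ hδ hL
  rw [tsub_le_iff_right, ENNReal.ofReal_div_of_pos hL, ← mul_div_assoc, ← ENNReal.add_div]
  gcongr
  refine (hC δ).trans ?_
  gcongr
  exact boundAt_le_expectedSamples (𝔸 δ) M ρ hMem hδ.1 hδ.2.le
    (hPC δ ⟨hδ.1, hδ.2.trans (by norm_num)⟩)

theorem asymptoticBound_eq_inv :
    asymptoticBound γ 𝓜 M =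
      (⨆ ω ∈ allocations M, ⨅ M' ∈ Alt γ 𝓜 M, information M M' ω)⁻¹ := by
  apply le_antisymm
  · simp only [ENNReal.inv_iSup]
    -- Any finite `b` above the inverse of the worst-case information makes `b • ω` feasible, of
    -- mass `b`. Working with `b` covers infinite worst-case information as well.
    refine le_iInf₂ fun ω hω => le_of_forall_gt_imp_ge_of_dense fun b hb => ?_
    by_cases hbt : b = ∞
    · rw [hbt]; exact le_top
    lift b to ℝ≥0 using hbt
    have hb0 : b ≠ 0 := by
      rintro rfl
      simp at hb
    have hb' : ∀ M' ∈ Alt γ 𝓜 M, ((b⁻¹ : ℝ≥0) : ℝ≥0∞) ≤ information M M' ω := by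
      rw [ENNReal.coe_inv hb0]
      exact le_iInf₂_iff.1 (ENNReal.inv_le_iff_inv_le.1 hb.le)
    refine (asymptoticBound_mul_le γ 𝓜 M ω hω.2 (inv_ne_zero hb0) hb').trans_eq ?_
    have hsum : ∑ z, (ω z : ℝ≥0∞) = 1 := by exact_mod_cast hω.1
    rw [hsum, mul_one, ENNReal.coe_inv hb0, inv_inv]
  · refine le_iInf₂ fun n hn => ?_
    rw [ENNReal.inv_le_iff_inv_le]
    -- The zero allocation is feasible only if there is no alternative. The supremum is then `∞`,
    -- for which `Ω(M)` must be nonempty.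
    by_cases hN : ∑ z, n z = 0
    · have hn0 : n = 0 := funext fun z => (Finset.sum_eq_zero_iff.1 hN) z (Finset.mem_univ z)
      have hAlt : ∀ M' ∈ Alt γ 𝓜 M, False := fun M' hM' => by
        have := hn.2 M' hM'
        simp [hn0, information] at this
      obtain ⟨ω, hω⟩ := allocations_nonempty M
      refine le_trans ?_ (le_iSup₂ ω hω)
      exact le_iInf₂ fun M' hM' => (hAlt M' hM').elim
    · have hN' : ((∑ z, n z : ℝ≥0) : ℝ≥0∞) = ∑ z, (n z : ℝ≥0∞) := by push_cast; rfl
      have hω : (∑ z, n z)⁻¹ • n ∈ allocations M := by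
        refine ⟨?_, fun s => by rw [netFlow_smul, hn.1, mul_zero]⟩
        simp only [Pi.smul_apply, smul_eq_mul]
        rw [← Finset.mul_sum, inv_mul_cancel₀ hN]
      refine le_trans (le_iInf₂ fun M' hM' => ?_) (le_iSup₂ (f := fun ω _ =>
        ⨅ M' ∈ Alt γ 𝓜 M, information M M' ω) _ hω)
      rw [information_smul, ENNReal.coe_inv hN, hN']
      exact le_mul_of_one_le_right zero_le (hn.2 M' hM')

end

end BPI

end


theorem mainTheorem3 {S A : Type*}
    [Fintype S] [Nonempty S] [MeasurableSpace S] [DiscreteMeasurableSpace S]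
    [Fintype A] [Nonempty A] [MeasurableSpace A] [DiscreteMeasurableSpace A]
    (γ : ℝ) (hγ0 : 0 ≤ γ) (hγ1 : γ < 1)
    (ρ : Measure S) [IsProbabilityMeasure ρ]
    (𝓜 : Set (BPI.MDP S A)) (M : BPI.MDP S A) (hM : M ∈ 𝓜) :
    (∀ (δ : ℝ) (𝔸 : BPI.Algorithm S A), 0 < δ → δ ≤ 1 / 2 → BPI.IsPC γ ρ 𝓜 δ 𝔸 →
      BPI.boundAt γ 𝓜 M δ ≤ BPI.expectedSamples M ρ 𝔸) ∧
    (∀ 𝔸 : ℝ → BPI.Algorithm S A, BPI.Communicating M →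
      (∀ δ ∈ Set.Ioo (0 : ℝ) 1, BPI.IsPC γ ρ 𝓜 δ (𝔸 δ)) →
      BPI.asymptoticBound γ 𝓜 M ≤
        liminf (fun δ : ℝ =>
          BPI.expectedSamples M ρ (𝔸 δ) / ENNReal.ofReal (Real.log (1 / δ))) (𝓝[>] 0)) ∧
    BPI.asymptoticBound γ 𝓜 M =
      (⨆ ω ∈ BPI.allocations M, ⨅ M' ∈ BPI.Alt γ 𝓜 M, BPI.information M M' ω)⁻¹ :=
  ⟨fun _ 𝔸 h0 h1 hPC => BPI.boundAt_le_expectedSamples 𝔸 M ρ hM h0 h1 hPC,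
    fun 𝔸 hcomm hPC => BPI.asymptoticBound_le_liminf γ 𝓜 M ρ hM 𝔸 hcomm hPC,
    BPI.asymptoticBound_eq_inv γ 𝓜 M⟩
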